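/- Let $n\ge 1$, $1<p<\infty$ and $0\le\lambda\le n$. For a locally integrable $b:\mathbb R^n\to\mathbb R$ put $\|b\|_*=\sup_Q \frac1{|Q|}\int_Q |b(y)-b_Q|\,dy$, where $b_Q=\frac1{|Q|}\int_Q b$ and the supremum is over all cubes $Q\subset\mathbb R^n$ with sides parallel to the coordinate axes; $b\in BMO(\mathbb R^n)$ means that $b$ is locally integrable and $\|b\|_*<\infty$. For a measurable function $b:\mathbb R^n\to\mathbb R$ the maximal commutator is $$C_b(f)(x)=\sup_{Q\ni x}\frac1{|Q|}\int_Q|b(x)-b(y)|\,|f(y)|\,dy\in[0,\infty],\qquad x\in\mathbb R^n .$$ The Morrey space $\mathcal M_{p,\lambda}(\mathbb R^n)$ consists of all $f\in L_p^{\rm loc}(\mathbb R^n)$ with $$\|f\|_{\mathcal M_{p,\lambda}}=\sup_{x\in\mathbb R^n,\,r>0} r^{\frac{\lambda-n}{p}}\|f\|_{L_p(B(x,r))}<\infty .$$ $C_b$ is said to be bounded on $\mathcal M_{p,\lambda}$ if there is a finite constant $c$ such that $C_b(f)\in\mathcal M_{p,\lambda}$ and $\|C_b(f)\|_{\mathcal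 M_{p,\lambda}}\le c\,\|f\|_{\mathcal M_{p,\lambda}}$ for all $f\in\mathcal M_{p,\lambda}$. Let $b:\mathbb R^n\to\mathbb R$ be measurable. If $0<\lambda\le n$, then $b\in BMO(\mathbb R^n)$ if and only if $C_b$ is bounded on $\mathcal M_{p,\lambda}$. Moreover, for every $0\le\lambda\le n$ (including $\lambda=0$), if $C_b$ is bounded on $\mathcal M_{p,\lambda}$, then $b\in BMO(\mathbb R^n)$. -/

import Mathlib

open MeasureTheory
open scoped ENNReal NNReal

noncomputable section

namespace MorreyCommutator

/-- Euclidean space `ℝⁿ`. -/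
abbrev Rn (n : ℕ) : Type := EuclideanSpace ℝ (Fin n)

/-- The closed cube with lower corner `a` and side length `l`, sides parallel to the axes. -/
def cube {n : ℕ} (a : Rn n) (l : ℝ) : Set (Rn n) :=
  {y | ∀ i, y i ∈ Set.Icc (a i) (a i + l)}

/-- The `BMO` seminorm: the supremum over all (nondegenerate) cubes `Q` of the mean over `Q`
of `|b - b_Q|`, as an extended nonnegative number. -/
def bmoSeminorm {n : ℕ} (b : Rn n → ℝ) : ℝ≥0∞ :=
  ⨆ (a : Rn n) (l : ℝ) (_ : 0 < l),
    ⨍⁻ y in cube a l, ‖b y - ⨍ z in cube a l, b z ∂volume‖ₑ ∂volume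

/-- `b ∈ BMO(ℝⁿ)`: `b` is locally integrable and its `BMO` seminorm is finite. -/
def MemBMO {n : ℕ} (b : Rn n → ℝ) : Prop :=
  LocallyIntegrable b volume ∧ bmoSeminorm b < ∞

/-- The maximal commutator `C_b(f)(x)`, the supremum over all cubes `Q` containing `x` of
the mean over `y ∈ Q` of `|b(x) - b(y)| |f(y)|`; the value `∞` is allowed. -/
def maximalCommutator {n : ℕ} (b f : Rn n → ℝ) (x : Rn n) : ℝ≥0∞ :=
  ⨆ (a : Rn n) (l : ℝ) (_ : 0 < l) (_ : x ∈ cube a l),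
    ⨍⁻ y in cube a l, ‖b x - b y‖ₑ * ‖f y‖ₑ ∂volume

/-- The Morrey norm `sup_{x, r > 0} r ^ ((lam - n) / p) * ‖f‖_{L_p(B(x, r))}`, for functions
with real or extended nonnegative values (for `p = ∞` the exponent is `0`). -/
def morreyNorm {n : ℕ} {ε : Type*} [ENorm ε] (p : ℝ≥0∞) (lam : ℝ) (f : Rn n → ε) : ℝ≥0∞ :=
  ⨆ (x : Rn n) (r : ℝ) (_ : 0 < r),
    ENNReal.ofReal (r ^ ((lam - n) / p.toReal)) *
      eLpNorm f p (volume.restrict (Metric.ball x r))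

/-- `f` belongs to the Morrey space: `f` is (measurable and) locally in `L_p` and its Morrey
norm is finite. -/
def MemMorrey {n : ℕ} {ε : Type*} [TopologicalSpace ε] [ContinuousENorm ε]
    (p : ℝ≥0∞) (lam : ℝ) (f : Rn n → ε) : Prop :=
  (∀ K : Set (Rn n), IsCompact K → MemLp f p (volume.restrict K)) ∧ morreyNorm p lam f < ∞

/-- `C_b` is bounded on the Morrey space: it maps the space into itself, and
`‖C_b f‖ ≤ c ‖f‖` for all `f` in the space with a constant `c` independent of `f`. -/
def MaximalCommutatorBounded {n : ℕ} (p : ℝ≥0∞) (lam : ℝ) (b : Rn n → ℝ) : Prop :=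
  ∃ c : ℝ≥0, ∀ f : Rn n → ℝ, MemMorrey p lam f →
    MemMorrey p lam (maximalCommutator b f) ∧
      morreyNorm p lam (maximalCommutator b f) ≤ c * morreyNorm p lam f

end MorreyCommutator

end

/-! Sufficiency is a weighted argument. The bound `|t| ≤ η⁻¹ (e^(ηt) + e^(-ηt))` with `t = b x - b
y` separates the variables: the commutator is dominated by `e^(ηb) M(e^(-ηb) |f|)` plus the same
expression with `-η` (`enorm_sub_le_expWeight`, `ratCommutator_le`). Bounding these twisted maximal
functions on `L_p` amounts to bounding `M` on `L_p` with weight `e^(ηpb)`. By John–Nirenberg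
(`MeanOscillationLE.exists_lintegral_exp_le`) averages of `e^(κb)` over a ball are comparable to
`e^(κm)`, `m` being the mean of `b`, once `|κ|` is small. Hence for small `η` the weight is doubling
and satisfies an `A_s` condition with some `s < p`, which reduces `M` to the maximal function of the
weighted measure, and that one is bounded on `L_(p/s)` by Vitali covering
(`BallDoubling.lintegral_iSup_rpow_le`).

For the Morrey norm on a ball `B`, the part of `f` in `5B` is handled by this global bound. The
cubes that meet `B` and leave `5B` are replaced by the dilates `5^k B`. Passing from `B` to `5^k B`
gains `5^(-kn)` in relative volume, loses a factor exponential in `k` with small rate because the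
means of `b` drift, and loses `5^(k(n-λ))` from the Morrey condition. The balance `5^(-kλ)` absorbs
the drift when `λ > 0` and `η` is small (`ExpMeanOscillation.expMeasure_mul_setLAverage_rpow_le`).

Necessity comes from testing on the indicator of a cube `Q`: there the commutator dominates the mean
over `y ∈ Q` of `|b x - b y|`, and Hölder together with `morreyNorm_indicator_cube_le` bounds its
average over `Q` independently of `Q` (`MaximalCommutatorBounded.memBMO`).

Cubes are closed balls of the sup metric on `Fin n → ℝ`, so the analysis takes place there and is
transferred to Euclidean space at the end. -/

noncomputable section

namespace MorreyCommutator

open Metric Set Filter Topology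

set_option linter.unusedSectionVars false

/-! ### Vitali covering and the maximal theorem for doubling measures. -/

section

variable {X : Type*} [MetricSpace X] [SecondCountableTopology X] [MeasurableSpace X] [BorelSpace X]

/-- All closed balls of positive radius have positive finite measure, and enlarging a ball five
times multiplies its measure by at most `D`. -/
structure BallDoubling (ν : Measure X) (D : ℝ≥0) : Prop where
  pos : ∀ x r, 0 < r → 0 < ν (closedBall x r)
  lt_top : ∀ x r, ν (closedBall x r) < ∞
  le_mul : ∀ x r, 0 < r → ν (closedBall x (5 * r)) ≤ D * ν (closedBall x r)

/-- Vitali's covering lemma; the selected family is countable because disjoint sets with nonempty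
interior are countably many in a second countable space. -/
theorem exists_countable_disjoint_enlargement {ι : Type*} (S : Set ι) (c : ι → X) (r : ι → ℝ)
    (R : ℝ) (hpos : ∀ i ∈ S, 0 < r i) (hR : ∀ i ∈ S, r i ≤ R) :
    ∃ u ⊆ S, u.Countable ∧ (u.PairwiseDisjoint fun i => closedBall (c i) (r i)) ∧
      ∀ i ∈ S, ∃ j ∈ u, closedBall (c i) (r i) ⊆ closedBall (c j) (5 * r j) := by
  obtain ⟨u, huS, hdisj, hcov⟩ :=
    Vitali.exists_disjoint_subfamily_covering_enlargement_closedBall S c r R hR 5 (by norm_num)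
  refine ⟨u, huS, ?_, hdisj, hcov⟩
  refine hdisj.countable_of_nonempty_interior fun i hi => ?_
  exact ⟨c i, ball_subset_interior_closedBall (mem_ball_self (hpos i (huS hi)))⟩

theorem BallDoubling.mul_measure_biUnion_le_of_bounded {ν : Measure X} {D : ℝ≥0}
    (hν : BallDoubling ν D) {ι : Type*} (S : Set ι) (c : ι → X) (r : ι → ℝ) (R : ℝ)
    (hpos : ∀ i ∈ S, 0 < r i) (hR : ∀ i ∈ S, r i ≤ R) (t : ℝ≥0∞) (h : X → ℝ≥0∞)
    (ht : ∀ i ∈ S, t * ν (closedBall (c i) (r i)) ≤ ∫⁻ y in closedBall (c i) (r i), h y ∂ν) :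
    t * ν (⋃ i ∈ S, closedBall (c i) (r i)) ≤ D * ∫⁻ y, h y ∂ν := by
  obtain ⟨u, huS, hu, hdisj, hcov⟩ := exists_countable_disjoint_enlargement S c r R hpos hR
  have hsub : (⋃ i ∈ S, closedBall (c i) (r i)) ⊆ ⋃ j ∈ u, closedBall (c j) (5 * r j) := by
    refine iUnion₂_subset fun i hi => ?_
    obtain ⟨j, hj, hij⟩ := hcov i hi
    exact hij.trans (subset_biUnion_of_mem (u := fun j => closedBall (c j) (5 * r j)) hj)
  have : Countable u := hu.to_subtype
  calc t * ν (⋃ i ∈ S, closedBall (c i) (r i))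
      ≤ t * ∑' j : u, ν (closedBall (c j) (5 * r j)) := by
        gcongr
        exact (measure_mono hsub).trans (measure_biUnion_le ν hu _)
    _ = ∑' j : u, t * ν (closedBall (c j) (5 * r j)) := ENNReal.tsum_mul_left.symm
    _ ≤ ∑' j : u, D * ∫⁻ y in closedBall (c j) (r j), h y ∂ν := by
        refine ENNReal.tsum_le_tsum fun j => ?_
        calc t * ν (closedBall (c j) (5 * r j))
            ≤ t * (D * ν (closedBall (c j) (r j))) := by
              gcongr; exact hν.le_mul _ _ (hpos j (huS j.2))
          _ = D * (t * ν (closedBall (c j) (r j))) := by ring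
          _ ≤ _ := by gcongr; exact ht j (huS j.2)
    _ = D * ∫⁻ y in ⋃ j ∈ u, closedBall (c j) (r j), h y ∂ν := by
        rw [ENNReal.tsum_mul_left,
          lintegral_biUnion hu (fun _ _ => measurableSet_closedBall) hdisj]
    _ ≤ D * ∫⁻ y, h y ∂ν := by gcongr; exact Measure.restrict_le_self

/-- The constant in the bounded case does not depend on the bound for the radii, so exhausting by
the balls of radius at most `N` and using continuity from below removes that bound. -/
theorem BallDoubling.mul_measure_biUnion_le {ν : Measure X} {D : ℝ≥0}
    (hν : BallDoubling ν D) {ι : Type*} (S : Set ι) (c : ι → X) (r : ι → ℝ)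
    (hpos : ∀ i ∈ S, 0 < r i) (t : ℝ≥0∞) (h : X → ℝ≥0∞)
    (ht : ∀ i ∈ S, t * ν (closedBall (c i) (r i)) ≤ ∫⁻ y in closedBall (c i) (r i), h y ∂ν) :
    t * ν (⋃ i ∈ S, closedBall (c i) (r i)) ≤ D * ∫⁻ y, h y ∂ν := by
  have hU : (⋃ i ∈ S, closedBall (c i) (r i)) =
      ⋃ N : ℕ, ⋃ i ∈ {i ∈ S | r i ≤ N}, closedBall (c i) (r i) := by
    ext x
    simp only [mem_iUnion, mem_ofPred_eq, exists_prop]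
    constructor
    · rintro ⟨i, hi, hx⟩
      obtain ⟨N, hN⟩ := exists_nat_ge (r i)
      exact ⟨N, i, ⟨hi, hN⟩, hx⟩
    · rintro ⟨N, i, hi, hx⟩
      exact ⟨i, hi.1, hx⟩
  have hmono : Monotone fun N : ℕ => ⋃ i ∈ {i ∈ S | r i ≤ N}, closedBall (c i) (r i) := by
    intro N M hNM
    refine biUnion_subset_biUnion_left fun i hi => ⟨hi.1, hi.2.trans ?_⟩
    exact_mod_cast hNM
  rw [hU, hmono.measure_iUnion, ENNReal.mul_iSup]
  exact iSup_le fun N => hν.mul_measure_biUnion_le_of_bounded _ c r N (fun i hi => hpos i hi.1)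
    (fun i hi => hi.2) t h (fun i hi => ht i hi.1)

/-- The pointwise layer-cake identity; the value `x = ∞` follows from finite values by monotonicity.
-/
theorem lintegral_Ioi_indicator_rpow {q : ℝ} (hq : 0 < q) (x : ℝ≥0∞) :
    ∫⁻ t in Ioi (0 : ℝ), {t : ℝ | ENNReal.ofReal t < x}.indicator
      (fun t => ENNReal.ofReal (q * t ^ (q - 1))) t = x ^ q := by
  have hmeas (x : ℝ≥0∞) : MeasurableSet {t : ℝ | ENNReal.ofReal t < x} :=
    measurableSet_lt ENNReal.measurable_ofReal measurable_const
  have hfin (y : ℝ) (hy : 0 ≤ y) : ∫⁻ t in Ioi (0 : ℝ), {t : ℝ | ENNReal.ofReal t <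
      ENNReal.ofReal y}.indicator (fun t => ENNReal.ofReal (q * t ^ (q - 1))) t =
        ENNReal.ofReal y ^ q := by
    rw [setLIntegral_indicator (hmeas _)]
    have hset : {t : ℝ | ENNReal.ofReal t < ENNReal.ofReal y} ∩ Ioi 0 = Ioo 0 y := by
      ext t
      simp only [mem_inter_iff, mem_ofPred_eq, mem_Ioi, mem_Ioo]
      constructor
      · rintro ⟨h1, h2⟩
        exact ⟨h2, (ENNReal.ofReal_lt_ofReal_iff_of_nonneg h2.le).1 h1⟩
      · rintro ⟨h1, h2⟩
        exact ⟨(ENNReal.ofReal_lt_ofReal_iff_of_nonneg h1.le).2 h2, h1⟩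
    have hint : IntervalIntegrable (fun t : ℝ => q * t ^ (q - 1)) volume 0 y :=
      (intervalIntegral.intervalIntegrable_rpow' (by linarith)).const_mul q
    rw [hset, setLIntegral_congr Ioo_ae_eq_Ioc, ← ofReal_integral_eq_lintegral_ofReal
      ((intervalIntegrable_iff_integrableOn_Ioc_of_le hy).1 hint), ENNReal.ofReal_rpow_of_nonneg hy
        hq.le, ← intervalIntegral.integral_of_le hy]
    · congr 1
      rw [intervalIntegral.integral_const_mul, integral_rpow (Or.inl (by linarith))]
      rw [sub_add_cancel, Real.zero_rpow hq.ne']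
      field_simp
      ring
    · filter_upwards [ae_restrict_mem measurableSet_Ioc] with t ht
      have := ht.1
      positivity
  rcases eq_or_ne x ∞ with rfl | hx
  · rw [ENNReal.top_rpow_of_pos hq, eq_top_iff]
    refine ENNReal.le_of_forall_nnreal_lt fun y _ => ?_
    have h1 := hfin ((y : ℝ) ^ q⁻¹) (by positivity)
    rw [← ENNReal.ofReal_rpow_of_nonneg (by positivity) (by positivity), ← ENNReal.rpow_mul,
      inv_mul_cancel₀ hq.ne', ENNReal.rpow_one, ENNReal.ofReal_coe_nnreal] at h1
    rw [← h1]
    refine lintegral_mono fun t => ?_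
    refine indicator_le_indicator_of_subset (fun s hs => ?_) (fun _ => zero_le) t
    have hs' : ENNReal.ofReal s < _ := hs
    exact lt_of_lt_of_le hs' le_top
  · have := hfin x.toReal ENNReal.toReal_nonneg
    rwa [ENNReal.ofReal_toReal hx] at this

/-- The weak-type bound sharpened by truncation: the values of `h` below `t / 2` contribute at most
half of the mass `t * ν B`, so the large values supply the other half. -/
theorem BallDoubling.mul_measure_lt_iSup_le {ν : Measure X} {D : ℝ≥0} (hν : BallDoubling ν D)
    {ι : Type*} (c : ι → X) (r : ι → ℝ) (hr : ∀ i, 0 < r i)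
    (h : X → ℝ≥0∞) {t : ℝ} (ht : 0 < t) :
    ENNReal.ofReal (t / 2) * ν {x | ENNReal.ofReal t <
      ⨆ i, (closedBall (c i) (r i)).indicator (fun _ => ⨍⁻ y in closedBall (c i) (r i), h y ∂ν) x}
    ≤ D * ∫⁻ y, {y | ENNReal.ofReal (t / 2) < h y}.indicator h y ∂ν := by
  have hset : {x | ENNReal.ofReal t < ⨆ i, (closedBall (c i) (r i)).indicator
        (fun _ => ⨍⁻ y in closedBall (c i) (r i), h y ∂ν) x} ⊆
      ⋃ i ∈ {i | ENNReal.ofReal t < ⨍⁻ y in closedBall (c i) (r i), h y ∂ν},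
        closedBall (c i) (r i) := by
    intro x hx
    obtain ⟨i, hi⟩ := lt_iSup_iff.1 (show ENNReal.ofReal t < _ from hx)
    by_cases hxi : x ∈ closedBall (c i) (r i)
    · rw [indicator_of_mem hxi] at hi
      exact mem_biUnion (show i ∈ {i | _} from hi) hxi
    · rw [indicator_of_notMem hxi] at hi
      exact absurd hi (not_lt.2 zero_le)
  refine (mul_le_mul_right (measure_mono hset) _).trans ?_
  refine hν.mul_measure_biUnion_le _ c r (fun i _ => hr i) _ _ fun i hi => ?_
  set B := closedBall (c i) (r i)
  have hB0 : ν B ≠ 0 := (hν.pos _ _ (hr i)).ne'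
  have hB1 : ν B ≠ ∞ := (hν.lt_top _ _).ne
  have hi' : ENNReal.ofReal t * ν B ≤ ∫⁻ y in B, h y ∂ν := by
    have : ENNReal.ofReal t < ⨍⁻ y in B, h y ∂ν := hi
    rw [setLAverage_eq] at this
    exact (ENNReal.le_div_iff_mul_le (Or.inl hB0) (Or.inl hB1)).1 this.le
  have hsplit : ∫⁻ y in B, h y ∂ν ≤
      ∫⁻ y in B, {y | ENNReal.ofReal (t / 2) < h y}.indicator h y ∂ν
        + ENNReal.ofReal (t / 2) * ν B := by
    rw [← setLIntegral_const B, ← lintegral_add_right _ measurable_const]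
    refine lintegral_mono fun y => ?_
    by_cases hy : ENNReal.ofReal (t / 2) < h y
    · have hy' : y ∈ {y | ENNReal.ofReal (t / 2) < h y} := hy
      rw [indicator_of_mem hy']
      exact le_self_add
    · exact (not_lt.1 hy).trans le_add_self
  have h2 : ENNReal.ofReal t = ENNReal.ofReal (t / 2) + ENNReal.ofReal (t / 2) := by
    rw [← ENNReal.ofReal_add (by positivity) (by positivity), add_halves]
  rw [h2, add_mul] at hi'
  exact (ENNReal.add_le_add_iff_right (ENNReal.mul_ne_top ENNReal.ofReal_ne_top hB1)).1
    (hi'.trans hsplit)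

/-- The maximal function of a countable family of balls is of strong type `(q, q)` for a doubling
measure. -/
theorem BallDoubling.lintegral_iSup_rpow_le {ν : Measure X} [SFinite ν] {D : ℝ≥0}
    (hν : BallDoubling ν D) {ι : Type*} [Countable ι] (c : ι → X) (r : ι → ℝ)
    (hr : ∀ i, 0 < r i) {h : X → ℝ≥0∞} (hh : Measurable h) {q : ℝ} (hq : 1 < q) :
    ∫⁻ x, (⨆ i, (closedBall (c i) (r i)).indicator
        (fun _ => ⨍⁻ y in closedBall (c i) (r i), h y ∂ν) x) ^ q ∂ν ≤
      (D * ENNReal.ofReal (2 * q / (q - 1) * 2 ^ (q - 1))) * ∫⁻ x, h x ^ q ∂ν := by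
  set M : X → ℝ≥0∞ := fun x => ⨆ i, (closedBall (c i) (r i)).indicator
        (fun _ => ⨍⁻ y in closedBall (c i) (r i), h y ∂ν) x with hM
  have hMm : Measurable M := .iSup fun i => measurable_const.indicator measurableSet_closedBall
  have hq0 : 0 < q := by linarith
  have hq1 : 0 < q - 1 := by linarith
  set φ : ℝ → ℝ≥0∞ := fun t => ENNReal.ofReal (q * t ^ (q - 1)) with hφ
  have hφm : Measurable φ := by fun_prop
  have hjoint1 : MeasurableSet {z : X × ℝ | ENNReal.ofReal z.2 < M z.1} :=
    measurableSet_lt (by fun_prop) (by fun_prop)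
  have hjoint2 : MeasurableSet {z : X × ℝ | ENNReal.ofReal (z.2 / 2) < h z.1} :=
    measurableSet_lt (by fun_prop) (by fun_prop)
  -- Marcinkiewicz interpolation: layer cake for `M`, the truncated weak bound at each height, then
  -- layer cake backwards with exponent `q - 1` at the value `2 * h x`. This last value produces `2
  -- ^ (q - 1)`; the factor `2 * q / (q - 1)` converts `q t^(q-1)` into `(q-1) t^(q-2)` times `t /
  -- 2`.
  calc ∫⁻ x, M x ^ q ∂ν
      = ∫⁻ x, (∫⁻ t in Ioi (0 : ℝ), {t : ℝ | ENNReal.ofReal t < M x}.indicator φ t) ∂ν :=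
        lintegral_congr fun x => (lintegral_Ioi_indicator_rpow hq0 _).symm
    _ = ∫⁻ t in Ioi (0 : ℝ), ∫⁻ x, {t : ℝ | ENNReal.ofReal t < M x}.indicator φ t ∂ν := by
        refine lintegral_lintegral_swap ?_
        exact ((hφm.comp measurable_snd).indicator hjoint1).aemeasurable
    _ ≤ ∫⁻ t in Ioi (0 : ℝ), ∫⁻ x, D * (ENNReal.ofReal (2 * q / (q - 1)) *
          (h x * {t : ℝ | ENNReal.ofReal (t / 2) < h x}.indicator
            (fun t => ENNReal.ofReal ((q - 1) * t ^ (q - 1 - 1))) t)) ∂ν := by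
        refine setLIntegral_mono' measurableSet_Ioi fun t (ht : 0 < t) => ?_
        have hw := hν.mul_measure_lt_iSup_le c r hr h ht
        have e1 : ∫⁻ x, {t : ℝ | ENNReal.ofReal t < M x}.indicator φ t ∂ν =
            φ t * ν {x | ENNReal.ofReal t < M x} := by
          rw [← lintegral_indicator_const (measurableSet_lt measurable_const hMm)]
          rfl
        have e2 : φ t = ENNReal.ofReal (2 * q / (q - 1)) *
            ENNReal.ofReal ((q - 1) * t ^ (q - 1 - 1)) * ENNReal.ofReal (t / 2) := by
          rw [← ENNReal.ofReal_mul (by positivity), ← ENNReal.ofReal_mul (by positivity)]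
          change ENNReal.ofReal _ = _
          congr 1
          rw [Real.rpow_sub_one ht.ne' (q - 1)]
          field_simp
        rw [e1, e2, mul_assoc]
        refine (mul_le_mul_right hw _).trans (le_of_eq ?_)
        rw [mul_left_comm, lintegral_const_mul _ (by
            refine measurable_const.mul (hh.mul ?_)
            exact (measurable_const (a := ENNReal.ofReal ((q - 1) * t ^ (q - 1 - 1)))).indicator
              (measurableSet_lt (measurable_const (a := ENNReal.ofReal (t / 2))) hh)),
          lintegral_const_mul _ (by
            refine hh.mul ?_
            exact (measurable_const (a := ENNReal.ofReal ((q - 1) * t ^ (q - 1 - 1)))).indicator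
              (measurableSet_lt (measurable_const (a := ENNReal.ofReal (t / 2))) hh)), mul_assoc,
          ← lintegral_const_mul _
            (hh.indicator (measurableSet_lt measurable_const hh))]
        congr 3
        funext x
        by_cases hx : ENNReal.ofReal (t / 2) < h x
        · simp only [indicator, mem_ofPred_eq, hx, if_true, mul_comm]
        · simp only [indicator, mem_ofPred_eq, hx, if_false, mul_zero]
    _ = ∫⁻ x, (∫⁻ t in Ioi (0 : ℝ), D * (ENNReal.ofReal (2 * q / (q - 1)) *
          (h x * {t : ℝ | ENNReal.ofReal (t / 2) < h x}.indicator
            (fun t => ENNReal.ofReal ((q - 1) * t ^ (q - 1 - 1))) t))) ∂ν := by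
        refine (lintegral_lintegral_swap ?_).symm
        refine (measurable_const.mul (measurable_const.mul ((hh.comp measurable_fst).mul
          ?_))).aemeasurable
        have : Measurable fun z : X × ℝ => ENNReal.ofReal ((q - 1) * z.2 ^ (q - 1 - 1)) := by
          fun_prop
        exact this.indicator hjoint2
    _ = ∫⁻ x, (D * ENNReal.ofReal (2 * q / (q - 1) * 2 ^ (q - 1))) * h x ^ q ∂ν := by
        refine lintegral_congr fun x => ?_
        have hm : Measurable ({t : ℝ | ENNReal.ofReal (t / 2) < h x}.indicator
            (fun t => ENNReal.ofReal ((q - 1) * t ^ (q - 1 - 1)))) := by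
          refine Measurable.indicator (by fun_prop) (measurableSet_lt (by fun_prop) (by fun_prop))
        have hs : {t : ℝ | ENNReal.ofReal (t / 2) < h x} = {t : ℝ | ENNReal.ofReal t < 2 * h x} := by
          ext t
          simp only [mem_ofPred_eq]
          rw [ENNReal.ofReal_div_of_pos (by norm_num), ENNReal.div_lt_iff (by simp) (by simp),
            mul_comm, ENNReal.ofReal_ofNat]
        rw [lintegral_const_mul _ (by fun_prop), lintegral_const_mul _ (by fun_prop),
          lintegral_const_mul _ hm, hs, lintegral_Ioi_indicator_rpow hq1,
          ENNReal.mul_rpow_of_nonneg _ _ hq1.le, ENNReal.ofReal_mul (by positivity),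
          ← ENNReal.ofReal_rpow_of_pos (by norm_num), ENNReal.ofReal_ofNat]
        have : h x ^ q = h x * h x ^ (q - 1) := by
          conv_lhs => rw [← add_sub_cancel 1 q]
          rw [ENNReal.rpow_add_of_nonneg _ _ zero_le_one hq1.le, ENNReal.rpow_one]
        rw [this]
        ring
    _ = _ := lintegral_const_mul _ (by fun_prop)

end

/-! ### The John–Nirenberg inequality on doubling spaces. -/

section

variable {X : Type*} [MetricSpace X] [SecondCountableTopology X] [MeasurableSpace X] [BorelSpace X]

/-- The mean of `b` over a closed ball. -/
def ballMean (μ : Measure X) (b : X → ℝ) (c : X) (r : ℝ) : ℝ := ⨍ z in closedBall c r, b z ∂μ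

/-- The mean oscillation of `b` over every closed ball is at most `A`. -/
structure MeanOscillationLE (μ : Measure X) (b : X → ℝ) (A : ℝ) : Prop where
  measurable : Measurable b
  integrableOn : ∀ c r, IntegrableOn b (closedBall c r) μ
  osc : ∀ c r, 0 < r →
    ∫ y in closedBall c r, |b y - ballMean μ b c r| ∂μ ≤ A * μ.real (closedBall c r)

section Doubling

variable {μ : Measure X} {D : ℝ≥0}

theorem BallDoubling.real_pos (hμ : BallDoubling μ D) (c : X) {r : ℝ} (hr : 0 < r) :
    0 < μ.real (closedBall c r) :=
  ENNReal.toReal_pos (hμ.pos c r hr).ne' (hμ.lt_top c r).ne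

theorem BallDoubling.real_le_mul (hμ : BallDoubling μ D) (c : X) {r : ℝ} (hr : 0 < r) :
    μ.real (closedBall c (5 * r)) ≤ D * μ.real (closedBall c r) := by
  have := ENNReal.toReal_mono (ENNReal.mul_ne_top ENNReal.coe_ne_top (hμ.lt_top c r).ne)
    (hμ.le_mul c r hr)
  rwa [ENNReal.toReal_mul] at this

theorem BallDoubling.one_le (hμ : BallDoubling μ D) (c : X) : (1 : ℝ) ≤ D := by
  have h1 := hμ.real_pos c one_pos
  have h2 := hμ.real_le_mul c one_pos
  have h3 : μ.real (closedBall c 1) ≤ μ.real (closedBall c (5 * 1)) :=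
    measureReal_mono (closedBall_subset_closedBall (by norm_num)) (hμ.lt_top _ _).ne
  nlinarith

theorem BallDoubling.isLocallyFiniteMeasure (hμ : BallDoubling μ D) : IsLocallyFiniteMeasure μ :=
  ⟨fun x => ⟨closedBall x 1, closedBall_mem_nhds x one_pos, hμ.lt_top x 1⟩⟩

theorem BallDoubling.isUnifLocDoublingMeasure (hμ : BallDoubling μ D) :
    IsUnifLocDoublingMeasure μ := by
  refine ⟨⟨D, ?_⟩⟩
  filter_upwards [self_mem_nhdsWithin] with r (hr : 0 < r) x
  exact (measure_mono (closedBall_subset_closedBall (by linarith))).trans (hμ.le_mul x r hr)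

theorem integrableOn_abs_sub_const {b : X → ℝ} {s : Set X} (hs : μ s ≠ ∞)
    (hb : IntegrableOn b s μ) (β : ℝ) : IntegrableOn (fun y => |b y - β|) s μ :=
  (hb.sub (integrableOn_const hs)).abs

theorem abs_average_sub_le {b : X → ℝ} {s : Set X} (hs0 : μ s ≠ 0) (hs : μ s ≠ ∞)
    (hb : IntegrableOn b s μ) (β : ℝ) :
    |(⨍ z in s, b z ∂μ) - β| ≤ (∫ y in s, |b y - β| ∂μ) / μ.real s := by
  have hpos : 0 < μ.real s := ENNReal.toReal_pos hs0 hs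
  have h1 : (⨍ z in s, b z ∂μ) - β = (∫ y in s, (b y - β) ∂μ) / μ.real s := by
    rw [setAverage_eq, integral_sub hb (integrableOn_const hs), setIntegral_const, smul_eq_mul,
      smul_eq_mul]
    field_simp
  rw [h1, abs_div, abs_of_pos hpos]
  gcongr
  exact abs_integral_le_integral_abs

variable {b : X → ℝ} {A : ℝ}

/-- The difference is at most the mean over the small ball of the deviation from the large mean, and
doubling compares that with the mean oscillation over the large ball. -/
theorem MeanOscillationLE.abs_ballMean_sub_le (hb : MeanOscillationLE μ b A)
    (hμ : BallDoubling μ D) (c : X) {r : ℝ} (hr : 0 < r) :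
    |ballMean μ b c r - ballMean μ b c (5 * r)| ≤ A * D := by
  have hr5 : 0 < 5 * r := by linarith
  refine (abs_average_sub_le (hμ.pos c r hr).ne' (hμ.lt_top c r).ne (hb.integrableOn c r) _).trans ?_
  have hpos := hμ.real_pos c hr
  rw [div_le_iff₀ hpos]
  have h1 : ∫ y in closedBall c r, |b y - ballMean μ b c (5 * r)| ∂μ ≤
      ∫ y in closedBall c (5 * r), |b y - ballMean μ b c (5 * r)| ∂μ := by
    refine setIntegral_mono_set ?_ (Eventually.of_forall fun _ => abs_nonneg _)
      (closedBall_subset_closedBall (by linarith)).eventuallyLE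
    exact integrableOn_abs_sub_const (hμ.lt_top c _).ne (hb.integrableOn _ _) _
  have h2 := hb.osc c (5 * r) hr5
  have hA : 0 ≤ A := by
    have h0 : 0 ≤ A * μ.real (closedBall c r) :=
      (integral_nonneg fun _ => abs_nonneg _).trans (hb.osc c r hr)
    exact nonneg_of_mul_nonneg_left h0 hpos
  calc _ ≤ _ := h1.trans h2
    _ ≤ A * (D * μ.real (closedBall c r)) := by gcongr; exact hμ.real_le_mul c hr
    _ = _ := by ring

theorem MeanOscillationLE.setIntegral_enlargement_le (hb : MeanOscillationLE μ b A)
    (hμ : BallDoubling μ D) (hA : 0 ≤ A) (c : X) {r : ℝ} (hr : 0 < r) :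
    ∫ y in closedBall c (5 * r), |b y - ballMean μ b c r| ∂μ ≤
      A * (1 + D) * D * μ.real (closedBall c r) := by
  have hr5 : 0 < 5 * r := by linarith
  have hD := hμ.one_le c
  have hi5 := hb.integrableOn c (5 * r)
  have hf5 := (hμ.lt_top c (5 * r)).ne
  have hd := hb.abs_ballMean_sub_le hμ c hr
  calc ∫ y in closedBall c (5 * r), |b y - ballMean μ b c r| ∂μ
      ≤ ∫ y in closedBall c (5 * r), (|b y - ballMean μ b c (5 * r)| + A * D) ∂μ := by
        refine integral_mono (integrableOn_abs_sub_const hf5 hi5 _)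
          ((integrableOn_abs_sub_const hf5 hi5 _).add (integrableOn_const hf5)) fun y => ?_
        have := abs_sub_le (b y) (ballMean μ b c (5 * r)) (ballMean μ b c r)
        rw [abs_sub_comm (ballMean μ b c (5 * r))] at this
        simp only
        linarith
    _ = ∫ y in closedBall c (5 * r), |b y - ballMean μ b c (5 * r)| ∂μ
          + A * D * μ.real (closedBall c (5 * r)) := by
        rw [integral_add (integrableOn_abs_sub_const hf5 hi5 _) (integrableOn_const hf5),
          setIntegral_const, smul_eq_mul, mul_comm (A * (D : ℝ))]
    _ ≤ A * μ.real (closedBall c (5 * r)) + A * D * μ.real (closedBall c (5 * r)) := by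
        gcongr; exact hb.osc c _ hr5
    _ = A * (1 + D) * μ.real (closedBall c (5 * r)) := by ring
    _ ≤ A * (1 + D) * (D * μ.real (closedBall c r)) := by gcongr; exact hμ.real_le_mul c hr
    _ = _ := by ring

/-- The Calderón–Zygmund stopping radius at a point where small balls have large mean oscillation
about the mean of the ambient ball. -/
theorem MeanOscillationLE.exists_stopping_radius (hb : MeanOscillationLE μ b A)
    (hμ : BallDoubling μ D) (hA : 0 ≤ A) {c x : X} {r : ℝ} (hr : 0 < r) (hx : x ∈ closedBall c r)
    {s : ℝ} (hs : A * (1 + D) * D * D ≤ s) {k : ℕ}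
    (hk : s < ⨍ y in closedBall x (r * 5⁻¹ ^ k), |b y - ballMean μ b c r| ∂μ) :
    ∃ ρ, 0 < ρ ∧ ρ ≤ r ∧ s < ⨍ y in closedBall x ρ, |b y - ballMean μ b c r| ∂μ ∧
      ⨍ y in closedBall x (5 * ρ), |b y - ballMean μ b c r| ∂μ ≤ s := by
  classical
  set a : ℕ → ℝ := fun k => ⨍ y in closedBall x (r * 5⁻¹ ^ k), |b y - ballMean μ b c r| ∂μ
  have hex : ∃ k, s < a k := ⟨k, hk⟩
  -- At scale `r` the average is still small, because the ball about `x` lies in the fivefold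
  -- enlargement of the ambient ball and has comparable measure.
  have h0 : ¬ s < a 0 := by
    have hsub : closedBall x r ⊆ closedBall c (5 * r) :=
      closedBall_subset_closedBall' (by have := mem_closedBall.1 hx; linarith)
    have hsub' : closedBall c r ⊆ closedBall x (5 * r) :=
      closedBall_subset_closedBall' (by have := mem_closedBall'.1 hx; linarith)
    have hpos := hμ.real_pos x hr
    rw [not_lt]
    refine le_trans ?_ hs
    simp only [a, pow_zero, mul_one]
    rw [setAverage_eq, smul_eq_mul, inv_mul_le_iff₀ hpos]
    calc ∫ y in closedBall x r, |b y - ballMean μ b c r| ∂μ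
        ≤ ∫ y in closedBall c (5 * r), |b y - ballMean μ b c r| ∂μ :=
          setIntegral_mono_set (integrableOn_abs_sub_const (hμ.lt_top c _).ne
            (hb.integrableOn _ _) _) (Eventually.of_forall fun _ => abs_nonneg _)
            hsub.eventuallyLE
      _ ≤ A * (1 + D) * D * μ.real (closedBall c r) := hb.setIntegral_enlargement_le hμ hA c hr
      _ ≤ A * (1 + D) * D * (D * μ.real (closedBall x r)) := by
          gcongr
          exact (measureReal_mono hsub' (hμ.lt_top _ _).ne).trans (hμ.real_le_mul x hr)
      _ = _ := by ring
  have hfind := Nat.find_spec hex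
  -- The stopping index is the first one whose average exceeds `s`; its predecessor has radius
  -- exactly `5 * ρ`, which gives the upper bound.
  obtain ⟨m, hm⟩ : ∃ m, Nat.find hex = m + 1 := by
    refine Nat.exists_eq_succ_of_ne_zero fun h => h0 ?_
    rwa [h] at hfind
  rw [hm] at hfind
  refine ⟨r * 5⁻¹ ^ (m + 1), by positivity, ?_, hfind, ?_⟩
  · exact mul_le_of_le_one_right hr.le (pow_le_one₀ (by norm_num) (by norm_num))
  · have := Nat.find_min hex (m := m) (by omega)
    have e : 5 * (r * 5⁻¹ ^ (m + 1)) = r * 5⁻¹ ^ m := by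
      rw [pow_succ]; ring
    rw [e]
    exact not_lt.1 this

/-- The inductive step of John–Nirenberg. By Lebesgue differentiation almost every point of the
higher level set has a stopping ball. The mean of `b` over a fivefold enlarged stopping ball is
within `s` of the ambient mean, so what exceeds `s` is a deviation above `τ` from the local mean,
and `hθ` applies there. The enlarged balls together carry at most half the measure of the original
one. -/
theorem MeanOscillationLE.measure_lt_add_le (hb : MeanOscillationLE μ b A)
    (hμ : BallDoubling μ D) (hA : 0 < A) {τ : ℝ} (hτ : 0 ≤ τ) {θ : ℝ≥0∞}
    (hθ : ∀ c r, 0 < r → μ {x ∈ closedBall c r | τ < |b x - ballMean μ b c r|} ≤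
      θ * μ (closedBall c r)) (c : X) {r : ℝ} (hr : 0 < r) :
    μ {x ∈ closedBall c r | 2 * (A * (1 + D) * D * D) + τ < |b x - ballMean μ b c r|} ≤
      θ * 2⁻¹ * μ (closedBall c r) := by
  have := hμ.isLocallyFiniteMeasure
  have := hμ.isUnifLocDoublingMeasure
  have hD := hμ.one_le c
  -- The factor `2` is what yields the gain `2⁻¹`: the enlarged stopping balls have total measure at
  -- most `D / s` times the integral of `g` over `5B`, itself at most `A (1 + D) D μ(B)`.
  set s : ℝ := 2 * (A * (1 + D) * D * D) with hsdef
  have hs0 : 0 < s := by positivity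
  set β := ballMean μ b c r with hβ
  set B := closedBall c r
  set g : X → ℝ := fun y => |b y - β| with hg
  have hgi (x : X) (ρ : ℝ) : IntegrableOn g (closedBall x ρ) μ :=
    integrableOn_abs_sub_const (hμ.lt_top x ρ).ne (hb.integrableOn x ρ) β
  have hgl : LocallyIntegrable g μ := fun x =>
    ⟨closedBall x 1, closedBall_mem_nhds x one_pos, hgi x 1⟩
  set T : Set X := {x ∈ B | ∃ ρ, 0 < ρ ∧ ρ ≤ r ∧ s < ⨍ y in closedBall x ρ, g y ∂μ ∧
      ⨍ y in closedBall x (5 * ρ), g y ∂μ ≤ s} with hT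
  choose! ρ hρ0 hρr hρs hρs' using fun (x : X) (hx : x ∈ T) => hx.2
  obtain ⟨u, huT, hu, hdisj, hcov⟩ := exists_countable_disjoint_enlargement T id ρ r hρ0 hρr
  simp only [id] at hdisj hcov
  have : Countable u := hu.to_subtype
  have hcover : {x ∈ B | s + τ < |b x - β|} ≤ᵐ[μ] ⋃ j ∈ u,
      {x ∈ closedBall j (5 * ρ j) | τ < |b x - ballMean μ b j (5 * ρ j)|} := by
    filter_upwards [IsUnifLocDoublingMeasure.ae_tendsto_average μ hgl 1] with x hx
    intro hxB
    obtain ⟨hxB, hxs⟩ : x ∈ B ∧ s + τ < |b x - β| := hxB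
    have hlim : Tendsto (fun k : ℕ => r * (5 : ℝ)⁻¹ ^ k) atTop (𝓝[>] 0) := by
      refine tendsto_nhdsWithin_iff.2 ⟨?_, Eventually.of_forall fun k => ?_⟩
      · simpa using (tendsto_pow_atTop_nhds_zero_of_lt_one (r := (5 : ℝ)⁻¹) (by norm_num)
          (by norm_num)).const_mul r
      · exact mul_pos hr (by positivity)
    have hlim2 := hx (fun _ : ℕ => x) _ hlim (Eventually.of_forall fun k =>
      mem_closedBall_self (by positivity))
    obtain ⟨k, hk⟩ := (hlim2.eventually (lt_mem_nhds (show s < g x by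
      simp only [hg]; linarith))).exists
    have hxT : x ∈ T := ⟨hxB, hb.exists_stopping_radius hμ hA.le hr hxB
      (by rw [hsdef]; have : 0 < A * (1 + D) * D * D := by positivity
          linarith) hk⟩
    obtain ⟨j, hj, hxj⟩ := hcov x hxT
    have hxj' := hxj (mem_closedBall_self (hρ0 x hxT).le)
    refine mem_biUnion hj ⟨hxj', ?_⟩
    have h5 : 0 < 5 * ρ j := by linarith [hρ0 j (huT hj)]
    have hm : |ballMean μ b j (5 * ρ j) - β| ≤ s := by
      refine (abs_average_sub_le (hμ.pos _ _ h5).ne' (hμ.lt_top _ _).ne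
        (hb.integrableOn _ _) β).trans ?_
      have := hρs' j (huT hj)
      rw [setAverage_eq, smul_eq_mul] at this
      rwa [div_eq_inv_mul]
    have := abs_sub_le (b x) (ballMean μ b j (5 * ρ j)) β
    linarith
  have hsum : ENNReal.ofReal s * ∑' j : u, μ (closedBall (j : X) (5 * ρ j)) ≤
      ENNReal.ofReal s * (2⁻¹ * μ B) := by
    calc ENNReal.ofReal s * ∑' j : u, μ (closedBall (j : X) (5 * ρ j))
        = ∑' j : u, ENNReal.ofReal s * μ (closedBall (j : X) (5 * ρ j)) :=
          ENNReal.tsum_mul_left.symm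
      _ ≤ ∑' j : u, D * ∫⁻ y in closedBall (j : X) (ρ j), ENNReal.ofReal (g y) ∂μ := by
          refine ENNReal.tsum_le_tsum fun j => ?_
          have hρj := hρ0 j (huT j.2)
          have hpos := hμ.real_pos (j : X) hρj
          calc ENNReal.ofReal s * μ (closedBall (j : X) (5 * ρ j))
              ≤ ENNReal.ofReal s * (D * μ (closedBall (j : X) (ρ j))) := by
                gcongr; exact hμ.le_mul _ _ hρj
            _ = D * ENNReal.ofReal (s * μ.real (closedBall (j : X) (ρ j))) := by
                rw [ENNReal.ofReal_mul hs0.le, ofReal_measureReal (hμ.lt_top _ _).ne]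
                ring
            _ ≤ _ := by
                gcongr
                rw [← ofReal_integral_eq_lintegral_ofReal (hgi _ _)
                  (Eventually.of_forall fun _ => abs_nonneg _)]
                have := hρs j (huT j.2)
                rw [setAverage_eq, smul_eq_mul, lt_inv_mul_iff₀ hpos, mul_comm] at this
                exact ENNReal.ofReal_le_ofReal this.le
      _ = D * ∫⁻ y in ⋃ j ∈ u, closedBall j (ρ j), ENNReal.ofReal (g y) ∂μ := by
          rw [ENNReal.tsum_mul_left,
            lintegral_biUnion hu (fun _ _ => measurableSet_closedBall) hdisj]
      _ ≤ D * ∫⁻ y in closedBall c (5 * r), ENNReal.ofReal (g y) ∂μ := by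
          gcongr
          refine iUnion₂_subset fun j hj => closedBall_subset_closedBall' ?_
          have h1 := mem_closedBall.1 (huT hj).1
          have h2 := hρr j (huT hj)
          linarith
      _ = D * ENNReal.ofReal (∫ y in closedBall c (5 * r), g y ∂μ) := by
          rw [ofReal_integral_eq_lintegral_ofReal (hgi _ _)
                  (Eventually.of_forall fun _ => abs_nonneg _)]
      _ ≤ D * ENNReal.ofReal (A * (1 + D) * D * μ.real B) := by
          gcongr
          exact hb.setIntegral_enlargement_le hμ hA.le c hr
      _ = ENNReal.ofReal s * (2⁻¹ * μ B) := by
          rw [← ENNReal.ofReal_coe_nnreal, ← ENNReal.ofReal_mul (by positivity),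
            ← ofReal_measureReal (μ := μ) (s := B) (hμ.lt_top _ _).ne,
            ← ENNReal.ofReal_ofNat 2, ← ENNReal.ofReal_inv_of_pos (by norm_num),
            ← ENNReal.ofReal_mul (by positivity), ← ENNReal.ofReal_mul (by positivity), hsdef]
          congr 1
          ring
  have hsum' := (ENNReal.mul_le_mul_iff_right (by simpa using hs0) ENNReal.ofReal_ne_top).1 hsum
  calc μ {x ∈ B | s + τ < |b x - β|}
      ≤ μ (⋃ j ∈ u, {x ∈ closedBall j (5 * ρ j) | τ < |b x - ballMean μ b j (5 * ρ j)|}) :=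
        measure_mono_ae hcover
    _ ≤ ∑' j : u, μ {x ∈ closedBall (j : X) (5 * ρ j) |
          τ < |b x - ballMean μ b j (5 * ρ j)|} := measure_biUnion_le μ hu _
    _ ≤ ∑' j : u, θ * μ (closedBall (j : X) (5 * ρ j)) :=
        ENNReal.tsum_le_tsum fun j => hθ _ _ (by linarith [hρ0 j (huT j.2)])
    _ ≤ θ * (2⁻¹ * μ B) := by rw [ENNReal.tsum_mul_left]; gcongr
    _ = _ := by ring

theorem MeanOscillationLE.measure_lt_mul_le (hb : MeanOscillationLE μ b A)
    (hμ : BallDoubling μ D) (hA : 0 < A) (k : ℕ) (c : X) {r : ℝ} (hr : 0 < r) :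
    μ {x ∈ closedBall c r | k * (2 * (A * (1 + D) * D * D)) < |b x - ballMean μ b c r|} ≤
      2⁻¹ ^ k * μ (closedBall c r) := by
  induction k generalizing c r with
  | zero =>
    rw [pow_zero, one_mul]
    exact measure_mono fun x hx => hx.1
  | succ k ih =>
    have := hb.measure_lt_add_le hμ hA (by positivity) (fun c r hr => ih c hr) c hr
    rw [pow_succ]
    refine le_trans (le_of_eq ?_) this
    push_cast
    congr 3
    funext x
    rw [add_mul, one_mul, add_comm]

/-- For `v > 0` the single term `k = ⌈v / s⌉ - 1` already dominates; the summand `1` covers `v = 0`.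
-/
theorem ofReal_exp_le_tsum {ε s v : ℝ} (hε : 0 < ε) (hs : 0 < s) (hv : 0 ≤ v) :
    ENNReal.ofReal (Real.exp (ε * v)) ≤ 1 + ∑' k : ℕ,
      {v : ℝ | k * s < v}.indicator (fun _ => ENNReal.ofReal (Real.exp (ε * s)) ^ (k + 1)) v := by
  rcases hv.eq_or_lt with rfl | hv
  · simp
  obtain ⟨k, hk⟩ : ∃ k : ℕ, ⌈v / s⌉₊ = k + 1 :=
    Nat.exists_eq_succ_of_ne_zero (Nat.ceil_pos.2 (by positivity)).ne'
  have h1 : v ≤ (k + 1) * s := by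
    have := Nat.le_ceil (v / s)
    rw [hk, div_le_iff₀ hs] at this
    exact_mod_cast this
  have h2 : k * s < v := by
    have : k < ⌈v / s⌉₊ := by omega
    rwa [Nat.lt_ceil, lt_div_iff₀ hs] at this
  refine le_trans ?_ (le_add_self.trans' (ENNReal.le_tsum k))
  rw [indicator_of_mem (show v ∈ {v : ℝ | k * s < v} from h2),
    ← ENNReal.ofReal_pow (Real.exp_pos _).le, ← Real.exp_nat_mul]
  refine ENNReal.ofReal_le_ofReal (Real.exp_le_exp.2 ?_)
  push_cast
  nlinarith

/-- The **John–Nirenberg inequality** on doubling metric measure spaces. -/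
theorem MeanOscillationLE.exists_lintegral_exp_le (hb : MeanOscillationLE μ b A)
    (hμ : BallDoubling μ D) (hA : 0 < A) : ∃ ε > 0, ∀ c r, 0 < r →
      ∫⁻ x in closedBall c r, ENNReal.ofReal (Real.exp (ε * |b x - ballMean μ b c r|)) ∂μ ≤
        7 * μ (closedBall c r) := by
  rcases isEmpty_or_nonempty X with hX | ⟨⟨c₀⟩⟩
  · exact ⟨1, one_pos, fun c => (hX.false c).elim⟩
  have hD := hμ.one_le c₀
  set s : ℝ := 2 * (A * (1 + D) * D * D) with hsdef
  have hs0 : 0 < s := by positivity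
  -- With this choice each level costs `3 / 2` against the decay `1 / 2`, so the ratio is `3 / 4`
  -- and the total is `1 + (3 / 2) * 4 = 7`.
  refine ⟨Real.log (3 / 2) / s, div_pos (Real.log_pos (by norm_num)) hs0, fun c r hr => ?_⟩
  set ε := Real.log (3 / 2) / s
  have hε : 0 < ε := div_pos (Real.log_pos (by norm_num)) hs0
  have hexp : ENNReal.ofReal (Real.exp (ε * s)) = 3 / 2 := by
    rw [div_mul_cancel₀ _ hs0.ne', Real.exp_log (by norm_num),
      ENNReal.ofReal_div_of_pos (by norm_num)]
    simp
  have hbm := hb.measurable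
  set B := closedBall c r
  set β := ballMean μ b c r
  have hm (k : ℕ) : MeasurableSet {x | k * s < |b x - β|} :=
    measurableSet_lt measurable_const (by fun_prop)
  calc ∫⁻ x in B, ENNReal.ofReal (Real.exp (ε * |b x - β|)) ∂μ
      ≤ ∫⁻ x in B, (1 + ∑' k : ℕ, {x | k * s < |b x - β|}.indicator
          (fun _ => (3 / 2 : ℝ≥0∞) ^ (k + 1)) x) ∂μ := by
        refine lintegral_mono fun x => ?_
        have := ofReal_exp_le_tsum hε hs0 (abs_nonneg (b x - β))
        rwa [hexp] at this
    _ = μ B + ∑' k : ℕ, (3 / 2 : ℝ≥0∞) ^ (k + 1) * μ {x ∈ B | k * s < |b x - β|} := by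
        rw [lintegral_add_left measurable_const, setLIntegral_one, lintegral_tsum
          fun k => (measurable_const.indicator (hm k)).aemeasurable]
        congr 2
        funext k
        rw [lintegral_indicator_const (hm k), Measure.restrict_apply (hm k), inter_comm]
        rfl
    _ ≤ μ B + ∑' k : ℕ, (3 / 2 : ℝ≥0∞) ^ (k + 1) * (2⁻¹ ^ k * μ B) := by
        gcongr with k
        exact hb.measure_lt_mul_le hμ hA k c hr
    _ = μ B + (3 / 2) * (∑' k : ℕ, (3 / 4 : ℝ≥0∞) ^ k) * μ B := by
        congr 1
        rw [← ENNReal.tsum_mul_left, ← ENNReal.tsum_mul_right]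
        congr 1
        funext k
        have : (3 / 4 : ℝ≥0∞) = 3 / 2 * 2⁻¹ := by
          rw [div_eq_mul_inv, div_eq_mul_inv, mul_assoc, ← ENNReal.mul_inv (by simp) (by simp)]
          norm_num
        rw [this, mul_pow, pow_succ]
        ring
    _ = 7 * μ B := by
        rw [ENNReal.tsum_geometric]
        have : (1 - 3 / 4 : ℝ≥0∞)⁻¹ = 4 := by
          have : (1 : ℝ≥0∞) - 3 / 4 = 1 / 4 := by
            rw [← ENNReal.toReal_eq_toReal_iff' (by simp) (by finiteness),
              ENNReal.toReal_sub_of_le _ (by simp)]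
            · simp; norm_num
            · exact ENNReal.div_le_of_le_mul (by norm_num)
          rw [this]; simp
        rw [this]
        have : (3 / 2 : ℝ≥0∞) * 4 = 6 := by
          rw [← ENNReal.toReal_eq_toReal_iff' (by finiteness) (by simp)]
          simp; norm_num
        rw [this]
        ring

end Doubling

end

/-! ### Exponential weights: doubling, the `A_s` condition and weighted maximal bounds. -/

section

/-- The exponential weight `exp (κ b)`. -/
def expWeight {X : Type*} (b : X → ℝ) (κ : ℝ) (x : X) : ℝ≥0∞ := ENNReal.ofReal (Real.exp (κ * b x))

section ExpWeight

variable {X : Type*} (b : X → ℝ) (κ κ' : ℝ) (x : X)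

theorem expWeight_mul : expWeight b κ x * expWeight b κ' x = expWeight b (κ + κ') x := by
  rw [expWeight, expWeight, expWeight, ← ENNReal.ofReal_mul (Real.exp_pos _).le, ← Real.exp_add,
    add_mul]

theorem expWeight_zero : expWeight b 0 x = 1 := by simp [expWeight]

theorem expWeight_rpow : expWeight b κ x ^ κ' = expWeight b (κ * κ') x := by
  rw [expWeight, expWeight, ENNReal.ofReal_rpow_of_pos (Real.exp_pos _), ← Real.exp_mul]
  ring_nf

theorem expWeight_le_of_abs_sub_le {y : X} {d : ℝ} (h : |b x - b y| ≤ d) :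
    expWeight b κ x ≤ ENNReal.ofReal (Real.exp (|κ| * d)) * expWeight b κ y := by
  rw [expWeight, expWeight, ← ENNReal.ofReal_mul (Real.exp_pos _).le, ← Real.exp_add]
  refine ENNReal.ofReal_le_ofReal (Real.exp_le_exp.2 ?_)
  have h1 : κ * (b x - b y) ≤ |κ| * d := (le_abs_self _).trans (by rw [abs_mul]; gcongr)
  linarith

theorem measurable_expWeight [MeasurableSpace X] (hb : Measurable b) :
    Measurable (expWeight b κ) := by
  unfold expWeight
  fun_prop

/-- Each exponential of `± η (b x - b y)` factors into a function of `x` times a function of `y`,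
which turns the commutator into weighted maximal functions. -/
theorem enorm_sub_le_expWeight {η : ℝ} (hη : 0 < η) (y : X) :
    ‖b x - b y‖ₑ ≤ ENNReal.ofReal η⁻¹ *
      (expWeight b η x * expWeight b (-η) y + expWeight b (-η) x * expWeight b η y) := by
  rw [expWeight, expWeight, expWeight, expWeight, ← ENNReal.ofReal_mul (Real.exp_pos _).le,
    ← ENNReal.ofReal_mul (Real.exp_pos _).le, ← ENNReal.ofReal_add (by positivity) (by positivity),
    ← ENNReal.ofReal_mul (by positivity), Real.enorm_eq_ofReal_abs]
  refine ENNReal.ofReal_le_ofReal ?_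
  rw [← Real.exp_add, ← Real.exp_add, le_inv_mul_iff₀ hη]
  have e1 := Real.add_one_le_exp (η * b x + -η * b y)
  have e2 := Real.add_one_le_exp (-η * b x + η * b y)
  have p1 := Real.exp_pos (η * b x + -η * b y)
  have p2 := Real.exp_pos (-η * b x + η * b y)
  rcases abs_cases (b x - b y) with h | h <;> rw [h.1] <;> nlinarith

end ExpWeight

variable {X : Type*} [MetricSpace X] [SecondCountableTopology X] [MeasurableSpace X] [BorelSpace X]
  {μ : Measure X} {D : ℝ≥0} {b : X → ℝ} {A ε : ℝ}

/-- The local exponential integrability provided by the John–Nirenberg inequality. -/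
def ExpMeanOscillation (μ : Measure X) (b : X → ℝ) (ε : ℝ) : Prop :=
  ∀ c r, 0 < r → ∫⁻ x in closedBall c r, ENNReal.ofReal (Real.exp (ε * |b x - ballMean μ b c r|)) ∂μ ≤
        7 * μ (closedBall c r)

theorem ExpMeanOscillation.setLIntegral_le (hε : ExpMeanOscillation μ b ε)
    {κ : ℝ} (hκ : |κ| ≤ ε) (c : X) {r : ℝ} (hr : 0 < r) :
    ∫⁻ x in closedBall c r, expWeight b κ x ∂μ ≤
      7 * ENNReal.ofReal (Real.exp (κ * ballMean μ b c r)) * μ (closedBall c r) := by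
  set m := ballMean μ b c r
  calc ∫⁻ x in closedBall c r, expWeight b κ x ∂μ
      ≤ ∫⁻ x in closedBall c r, ENNReal.ofReal (Real.exp (κ * m)) *
          ENNReal.ofReal (Real.exp (ε * |b x - m|)) ∂μ := by
        refine lintegral_mono fun x => ?_
        rw [expWeight, ← ENNReal.ofReal_mul (Real.exp_pos _).le, ← Real.exp_add]
        refine ENNReal.ofReal_le_ofReal (Real.exp_le_exp.2 ?_)
        have h1 : κ * (b x - m) ≤ ε * |b x - m| :=
          (le_abs_self _).trans (by rw [abs_mul]; gcongr)
        linarith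
    _ ≤ ENNReal.ofReal (Real.exp (κ * m)) * (7 * μ (closedBall c r)) := by
        rw [lintegral_const_mul' _ _ ENNReal.ofReal_ne_top]
        gcongr
        exact hε c r hr
    _ = _ := by ring

/-- Jensen's inequality, by integrating the tangent line of the exponential at the mean. The
John–Nirenberg bound supplies the integrability of `exp (κ b)`. -/
theorem ExpMeanOscillation.le_setLIntegral (hε : ExpMeanOscillation μ b ε)
    (hμ : BallDoubling μ D) (hb : MeanOscillationLE μ b A)
    {κ : ℝ} (hκ : |κ| ≤ ε) (c : X) {r : ℝ} (hr : 0 < r) :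
    ENNReal.ofReal (Real.exp (κ * ballMean μ b c r)) * μ (closedBall c r) ≤
      ∫⁻ x in closedBall c r, expWeight b κ x ∂μ := by
  have hbm := hb.measurable
  have hB := (hμ.lt_top c r).ne
  have hB0 := hμ.real_pos c hr
  set m := ballMean μ b c r with hm
  have hfin : ∫⁻ x in closedBall c r, expWeight b κ x ∂μ < ∞ :=
    (hε.setLIntegral_le hκ c hr).trans_lt (by finiteness)
  have hint : IntegrableOn (fun x => Real.exp (κ * b x)) (closedBall c r) μ := by
    refine ⟨(by fun_prop : Measurable fun x => Real.exp (κ * b x)).aestronglyMeasurable, ?_⟩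
    refine lt_of_le_of_lt (le_of_eq ?_) hfin
    exact lintegral_congr fun x => by rw [Real.enorm_eq_ofReal (Real.exp_pos _).le, expWeight]
  have hlin : IntegrableOn (fun x => Real.exp (κ * m) * (1 + κ * (b x - m))) (closedBall c r) μ :=
    ((integrableOn_const hB).add
      (((hb.integrableOn c r).sub (integrableOn_const hB)).const_mul κ)).const_mul _
  have hval : ∫ x in closedBall c r, Real.exp (κ * m) * (1 + κ * (b x - m)) ∂μ =
      Real.exp (κ * m) * μ.real (closedBall c r) := by
    have h1 : IntegrableOn (fun _ : X => (1 : ℝ)) (closedBall c r) μ := integrableOn_const hB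
    have h2 : IntegrableOn (fun _ : X => m) (closedBall c r) μ := integrableOn_const hB
    have h3 : IntegrableOn (fun x => κ * (b x - m)) (closedBall c r) μ :=
      ((hb.integrableOn c r).sub h2).const_mul κ
    rw [integral_const_mul, integral_add h1 h3,
      integral_const_mul, integral_sub (hb.integrableOn c r) h2, setIntegral_const,
      setIntegral_const, hm, ballMean, setAverage_eq, smul_eq_mul, smul_eq_mul, smul_eq_mul,
      mul_inv_cancel_left₀ hB0.ne']
    ring
  calc ENNReal.ofReal (Real.exp (κ * m)) * μ (closedBall c r)
      = ENNReal.ofReal (∫ x in closedBall c r, Real.exp (κ * m) * (1 + κ * (b x - m)) ∂μ) := by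
        rw [hval, ENNReal.ofReal_mul (Real.exp_pos _).le, ofReal_measureReal hB]
    _ ≤ ENNReal.ofReal (∫ x in closedBall c r, Real.exp (κ * b x) ∂μ) := by
        refine ENNReal.ofReal_le_ofReal (integral_mono hlin hint fun x => ?_)
        have h1 := Real.add_one_le_exp (κ * (b x - m))
        have h2 : Real.exp (κ * b x) = Real.exp (κ * m) * Real.exp (κ * (b x - m)) := by
          rw [← Real.exp_add]; ring_nf
        simp only [h2]
        gcongr
        linarith
    _ = _ := ofReal_integral_eq_lintegral_ofReal hint
        (Eventually.of_forall fun _ => (Real.exp_pos _).le)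

/-- The measure with density `exp (κ b)`. -/
def expMeasure (μ : Measure X) (b : X → ℝ) (κ : ℝ) : Measure X := μ.withDensity (expWeight b κ)

theorem expMeasure_closedBall (κ : ℝ) (c : X) (r : ℝ) :
    expMeasure μ b κ (closedBall c r) = ∫⁻ x in closedBall c r, expWeight b κ x ∂μ :=
  withDensity_apply _ measurableSet_closedBall

/-- The weighted mass of a ball is `exp (κ m) * μ B` up to a factor `7`, and enlarging the ball
moves the mean `m` by at most `A * D`. -/
theorem ExpMeanOscillation.ballDoubling (hε : ExpMeanOscillation μ b ε)
    (hμ : BallDoubling μ D) (hb : MeanOscillationLE μ b A) {κ : ℝ} (hκ : |κ| ≤ ε) :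
    BallDoubling (expMeasure μ b κ) (7 * (Real.exp (|κ| * (A * D))).toNNReal * D) where
  pos c r hr := by
    rw [expMeasure_closedBall]
    refine lt_of_lt_of_le ?_ (hε.le_setLIntegral hμ hb hκ c hr)
    exact ENNReal.mul_pos (by simpa using Real.exp_pos _) (hμ.pos c r hr).ne'
  lt_top c r := by
    rw [expMeasure_closedBall]
    rcases lt_or_ge 0 r with hr | hr
    · refine (hε.setLIntegral_le hκ c hr).trans_lt ?_
      have := hμ.lt_top c r
      finiteness
    · refine (lintegral_mono_set (closedBall_subset_closedBall (hr.trans zero_le_one))).trans_lt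
        ((hε.setLIntegral_le hκ c one_pos).trans_lt ?_)
      have := hμ.lt_top c 1
      finiteness
  le_mul c r hr := by
    rw [expMeasure_closedBall, expMeasure_closedBall]
    have hd := hb.abs_ballMean_sub_le hμ c hr
    rw [abs_sub_comm] at hd
    refine (hε.setLIntegral_le hκ c (by positivity)).trans ?_
    -- Taking the identity of `ℝ` as the function compares the exponentials of the two means
    -- themselves.
    have h1 := expWeight_le_of_abs_sub_le (X := ℝ) id κ (ballMean μ b c (5 * r)) hd
    simp only [expWeight, id] at h1
    calc _ ≤ 7 * (ENNReal.ofReal (Real.exp (|κ| * (A * D))) *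
          ENNReal.ofReal (Real.exp (κ * ballMean μ b c r))) * (D * μ (closedBall c r)) := by
          gcongr 7 * ?_ * ?_
          · exact h1
          · exact hμ.le_mul c r hr
      _ = 7 * ENNReal.ofReal (Real.exp (|κ| * (A * D))) * D *
          (ENNReal.ofReal (Real.exp (κ * ballMean μ b c r)) * μ (closedBall c r)) := by ring
      _ ≤ 7 * ENNReal.ofReal (Real.exp (|κ| * (A * D))) * D *
          ∫⁻ x in closedBall c r, expWeight b κ x ∂μ := by
          gcongr
          exact hε.le_setLIntegral hμ hb hκ c hr
      _ = _ := by push_cast; rfl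

/-- The `A_s` property of the weight `exp (κ b)`, in the form of a comparison of averages. -/
theorem ExpMeanOscillation.setLAverage_le (hε : ExpMeanOscillation μ b ε)
    (hμ : BallDoubling μ D) (hb : MeanOscillationLE μ b A) {κ s : ℝ} (hs : 1 < s)
    (hκ : |κ| ≤ ε) (hκs : |κ| / (s - 1) ≤ ε) (c : X) {r : ℝ} (hr : 0 < r) {F : X → ℝ≥0∞}
    (hF : Measurable F) :
    ⨍⁻ x in closedBall c r, F x ∂μ ≤
      7 * (⨍⁻ x in closedBall c r, F x ^ s ∂(expMeasure μ b κ)) ^ s⁻¹ := by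
  have hs0 : 0 < s := by linarith
  have hs1 : 0 < s - 1 := by linarith
  have hbm := hb.measurable
  set B := closedBall c r with hBdef
  set ν := expMeasure μ b κ with hν
  have hμB0 : μ B ≠ 0 := (hμ.pos c r hr).ne'
  have hμB := (hμ.lt_top c r).ne
  have hνd := hε.ballDoubling hμ hb hκ
  have hνB0 : ν B ≠ 0 := (hνd.pos c r hr).ne'
  have hνB : ν B ≠ ∞ := (hνd.lt_top c r).ne
  set m := ballMean μ b c r with hm
  have hconj : s.HolderConjugate (s.conjExponent) := .conjExponent hs
  set s' := s.conjExponent with hs'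
  have hs'eq : s' = s / (s - 1) := rfl
  have hs'0 : 0 < s' := hconj.symm.pos
  -- Hölder for `F = (F w^(1/s)) * w^(-1/s)` with `w = exp (κ b)`; the dual weight is
  -- `w^(-1/(s-1))`, whence the hypothesis `hκs`.
  have hholder : ∫⁻ x in B, F x ∂μ ≤ (∫⁻ x in B, F x ^ s ∂ν) ^ s⁻¹ *
      (∫⁻ x in B, expWeight b (-(κ / (s - 1))) x ∂μ) ^ s'⁻¹ := by
    have h := ENNReal.lintegral_mul_le_Lp_mul_Lq (μ.restrict B) hconj
      (f := fun x => F x * expWeight b (κ / s) x) (g := fun x => expWeight b (-(κ / s)) x)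
      (hF.mul (measurable_expWeight b _ hbm)).aemeasurable
      (measurable_expWeight b _ hbm).aemeasurable
    rw [one_div, one_div] at h
    refine (le_of_eq ?_).trans (h.trans (le_of_eq ?_))
    · refine lintegral_congr fun x => ?_
      simp only [Pi.mul_apply]
      rw [mul_assoc, expWeight_mul, add_neg_cancel, expWeight_zero, mul_one]
    · congr 2
      · rw [hν, expMeasure, setLIntegral_withDensity_eq_setLIntegral_mul _
          (measurable_expWeight b _ hbm) (hF.pow_const s) measurableSet_closedBall]
        refine lintegral_congr fun x => ?_
        simp only [Pi.mul_apply]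
        rw [ENNReal.mul_rpow_of_nonneg _ _ hs0.le, expWeight_rpow, div_mul_cancel₀ _ hs0.ne',
          mul_comm]
      · refine lintegral_congr fun x => ?_
        rw [expWeight_rpow, hs'eq]
        congr 1
        field_simp
  have hdual : (∫⁻ x in B, expWeight b (-(κ / (s - 1))) x ∂μ) ^ s'⁻¹ ≤
      (7 * μ B) ^ s'⁻¹ * ENNReal.ofReal (Real.exp (-κ * m)) ^ s⁻¹ := by
    calc _ ≤ (7 * ENNReal.ofReal (Real.exp (-(κ / (s - 1)) * m)) * μ B) ^ s'⁻¹ := by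
          gcongr
          refine hε.setLIntegral_le ?_ c hr
          rwa [abs_neg, abs_div, abs_of_pos hs1]
      _ = ((7 * μ B) * ENNReal.ofReal (Real.exp (-(κ / (s - 1)) * m))) ^ s'⁻¹ := by
          congr 1; ring
      _ = _ := by
          rw [ENNReal.mul_rpow_of_nonneg _ _ (by positivity),
            ENNReal.ofReal_rpow_of_pos (Real.exp_pos _), ENNReal.ofReal_rpow_of_pos (Real.exp_pos _),
            ← Real.exp_mul, ← Real.exp_mul, hs'eq]
          congr 3
          field_simp
  have hinv : ENNReal.ofReal (Real.exp (-κ * m)) ≤ 7 * μ B * (ν B)⁻¹ := by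
    rw [← div_eq_mul_inv, ENNReal.le_div_iff_mul_le (Or.inl hνB0) (Or.inl hνB)]
    have h := hε.setLIntegral_le hκ c hr
    rw [← expMeasure_closedBall] at h
    calc _ ≤ ENNReal.ofReal (Real.exp (-κ * m)) * (7 * ENNReal.ofReal (Real.exp (κ * m)) * μ B) := by
          gcongr
      _ = (ENNReal.ofReal (Real.exp (-κ * m)) * ENNReal.ofReal (Real.exp (κ * m))) * (7 * μ B) := by
          ring
      _ = 7 * μ B := by
          rw [← ENNReal.ofReal_mul (Real.exp_pos _).le, ← Real.exp_add]
          simp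
  rw [setLAverage_eq, ENNReal.div_le_iff hμB0 hμB, setLAverage_eq]
  calc ∫⁻ x in B, F x ∂μ
      ≤ (∫⁻ x in B, F x ^ s ∂ν) ^ s⁻¹ * ((7 * μ B) ^ s'⁻¹ * (7 * μ B * (ν B)⁻¹) ^ s⁻¹) := by
        refine hholder.trans ?_
        gcongr
        exact hdual.trans (by gcongr)
    _ = ((7 * μ B) ^ s'⁻¹ * (7 * μ B) ^ s⁻¹) * ((∫⁻ x in B, F x ^ s ∂ν) / ν B) ^ s⁻¹ := by
        rw [ENNReal.mul_rpow_of_nonneg (7 * μ B) _ (inv_nonneg.2 hs0.le), div_eq_mul_inv,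
          ENNReal.mul_rpow_of_nonneg _ (ν B)⁻¹ (inv_nonneg.2 hs0.le)]
        ring
    -- The conjugate exponents recombine the two powers of `7 * μ B`, leaving a single factor `7`.
    _ = _ := by
        rw [← ENNReal.rpow_add _ _ (mul_ne_zero (by norm_num) hμB0)
          (ENNReal.mul_ne_top (by norm_num) hμB), add_comm, hconj.inv_add_inv_eq_one,
          ENNReal.rpow_one]
        ring

/-- The maximal function twisted by the weight `exp (η b)`, along a family of balls. -/
def twistedMaximal (μ : Measure X) (b : X → ℝ) (η : ℝ) {ι : Type*} (c : ι → X) (r : ι → ℝ)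
    (g : X → ℝ≥0∞) (x : X) : ℝ≥0∞ :=
  ⨆ i, (closedBall (c i) (r i)).indicator (fun _ => expWeight b η x *
    ⨍⁻ y in closedBall (c i) (r i), expWeight b (-η) y * g y ∂μ) x

/-- The `A_s` comparison bounds the averages for `μ` by averages of `F ^ s` for `ν = exp (ηpb) μ`,
whose maximal function is bounded on `L_(p/s)(ν)`. The factor `exp (-ηpb)` in `F ^ p` then cancels
the density of `ν`. -/
theorem ExpMeanOscillation.lintegral_twistedMaximal_le [SFinite μ] (hε : ExpMeanOscillation μ b ε)
    (hμ : BallDoubling μ D) (hb : MeanOscillationLE μ b A) {p : ℝ} (hp : 1 < p) {η : ℝ}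
    (hη : |η| * p ≤ ε) (hη' : |η| * p / ((p - 1) / 2) ≤ ε)
    {ι : Type*} [Countable ι] (c : ι → X) (r : ι → ℝ) (hr : ∀ i, 0 < r i) :
    ∃ C : ℝ≥0∞, C ≠ ∞ ∧ ∀ g : X → ℝ≥0∞, Measurable g →
      ∫⁻ x, twistedMaximal μ b η c r g x ^ p ∂μ ≤ C * ∫⁻ x, g x ^ p ∂μ := by
  have hbm := hb.measurable
  have hp0 : 0 < p := by linarith
  -- The midpoint of `1` and `p` leaves room on both sides: `s > 1` for Hölder and `p / s > 1` for
  -- the strong type bound. It makes `s - 1` equal to the `(p - 1) / 2` of `hη'`.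
  set s := (p + 1) / 2 with hsdef
  have hs1 : 1 < s := by linarith
  have hs0 : 0 < s := by linarith
  have hq : 1 < p / s := by rw [one_lt_div hs0]; linarith
  have hκ : |η * p| ≤ ε := by rwa [abs_mul, abs_of_pos hp0]
  have hκs : |η * p| / (s - 1) ≤ ε := by
    rw [abs_mul, abs_of_pos hp0]
    convert hη' using 2
    rw [hsdef]; ring
  set ν := expMeasure μ b (η * p) with hν
  have hνd := hε.ballDoubling hμ hb hκ
  have : SFinite ν := by rw [hν, expMeasure]; infer_instance
  set D' : ℝ≥0 := 7 * (Real.exp (|η * p| * (A * D))).toNNReal * D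
  refine ⟨7 ^ p * (D' * ENNReal.ofReal (2 * (p / s) / (p / s - 1) * 2 ^ (p / s - 1))),
    ENNReal.mul_ne_top (ENNReal.rpow_ne_top_of_nonneg hp0.le (by norm_num)) (by finiteness),
    fun g hg => ?_⟩
  set F : X → ℝ≥0∞ := fun y => expWeight b (-η) y * g y with hF
  have hFm : Measurable F := (measurable_expWeight b _ hbm).mul hg
  set M : X → ℝ≥0∞ := fun x => ⨆ i, (closedBall (c i) (r i)).indicator
        (fun _ => ⨍⁻ y in closedBall (c i) (r i), F y ^ s ∂ν) x with hM
  have hMm : Measurable M := .iSup fun i => measurable_const.indicator measurableSet_closedBall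
  have hpt (x : X) : twistedMaximal μ b η c r g x ≤ expWeight b η x * (7 * M x ^ s⁻¹) := by
    refine iSup_le fun i => ?_
    by_cases hx : x ∈ closedBall (c i) (r i)
    swap
    · rw [indicator_of_notMem hx]
      exact zero_le
    rw [indicator_of_mem hx]
    gcongr
    refine (hε.setLAverage_le hμ hb hs1 hκ hκs (c i) (hr i) hFm).trans ?_
    gcongr
    refine le_trans ?_ (le_iSup _ i)
    rw [indicator_of_mem hx]
  have hstrong := hνd.lintegral_iSup_rpow_le c r hr (h := fun y => F y ^ s) (hFm.pow_const s) hq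
  calc ∫⁻ x, twistedMaximal μ b η c r g x ^ p ∂μ
      ≤ ∫⁻ x, 7 ^ p * (expWeight b (η * p) x * M x ^ (p / s)) ∂μ := by
        refine lintegral_mono fun x => ?_
        refine (ENNReal.rpow_le_rpow (hpt x) hp0.le).trans (le_of_eq ?_)
        rw [ENNReal.mul_rpow_of_nonneg _ _ hp0.le, ENNReal.mul_rpow_of_nonneg _ _ hp0.le,
          expWeight_rpow, ← ENNReal.rpow_mul, ← div_eq_inv_mul]
        ring
    _ = 7 ^ p * ∫⁻ x, M x ^ (p / s) ∂ν := by
        rw [lintegral_const_mul' _ _ (ENNReal.rpow_ne_top_of_nonneg hp0.le (by norm_num)), hν,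
          expMeasure, lintegral_withDensity_eq_lintegral_mul _ (measurable_expWeight b _ hbm)
            (hMm.pow_const _)]
        rfl
    _ ≤ 7 ^ p * ((D' * ENNReal.ofReal (2 * (p / s) / (p / s - 1) * 2 ^ (p / s - 1))) *
          ∫⁻ x, (F x ^ s) ^ (p / s) ∂ν) := by gcongr
    _ = _ := by
        rw [← mul_assoc]
        congr 1
        rw [hν, expMeasure, lintegral_withDensity_eq_lintegral_mul _ (measurable_expWeight b _ hbm)
            ((hFm.pow_const _).pow_const _)]
        refine lintegral_congr fun x => ?_
        simp only [Pi.mul_apply, hF]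
        rw [← ENNReal.rpow_mul, mul_div_cancel₀ _ hs0.ne', ENNReal.mul_rpow_of_nonneg _ _ hp0.le,
          expWeight_rpow, ← mul_assoc, expWeight_mul]
        ring_nf
        rw [expWeight_zero, one_mul]

theorem MeanOscillationLE.abs_ballMean_sub_pow_le (hb : MeanOscillationLE μ b A)
    (hμ : BallDoubling μ D) (c : X) {r : ℝ} (hr : 0 < r) (k : ℕ) :
    |ballMean μ b c r - ballMean μ b c (5 ^ k * r)| ≤ k * (A * D) := by
  induction k with
  | zero => simp
  | succ k ih =>
    have h := hb.abs_ballMean_sub_le hμ c (r := 5 ^ k * r) (by positivity)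
    rw [← mul_assoc, ← pow_succ'] at h
    have := abs_sub_le (ballMean μ b c r) (ballMean μ b c (5 ^ k * r))
      (ballMean μ b c (5 ^ (k + 1) * r))
    push_cast
    linarith

/-- The mean density of the weighted measure changes between a ball and its `5 ^ k` dilate by a
factor at most exponential in `k`, at a rate proportional to `|κ|`, since the means of `b` drift at
most linearly in `k`. -/
theorem ExpMeanOscillation.expMeasure_mul_le (hε : ExpMeanOscillation μ b ε)
    (hμ : BallDoubling μ D) (hb : MeanOscillationLE μ b A) {κ : ℝ} (hκ : |κ| ≤ ε)
    (c : X) {r : ℝ} (hr : 0 < r) (k : ℕ) :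
    expMeasure μ b κ (closedBall c r) * μ (closedBall c (5 ^ k * r)) ≤
      7 * ENNReal.ofReal (Real.exp (|κ| * (k * (A * D)))) * μ (closedBall c r) *
        expMeasure μ b κ (closedBall c (5 ^ k * r)) := by
  rw [expMeasure_closedBall, expMeasure_closedBall]
  have h1 := expWeight_le_of_abs_sub_le (X := ℝ) id κ (ballMean μ b c r)
    (hb.abs_ballMean_sub_pow_le hμ c hr k)
  simp only [expWeight, id] at h1
  calc _ ≤ (7 * (ENNReal.ofReal (Real.exp (|κ| * (k * (A * D)))) *
        ENNReal.ofReal (Real.exp (κ * ballMean μ b c (5 ^ k * r)))) * μ (closedBall c r)) *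
          μ (closedBall c (5 ^ k * r)) := by
        gcongr
        exact (hε.setLIntegral_le hκ c hr).trans (mul_le_mul_left (mul_le_mul_right h1 _) _)
    _ = (7 * ENNReal.ofReal (Real.exp (|κ| * (k * (A * D)))) * μ (closedBall c r)) *
        (ENNReal.ofReal (Real.exp (κ * ballMean μ b c (5 ^ k * r))) *
          μ (closedBall c (5 ^ k * r))) := by ring
    _ ≤ _ := by
        gcongr
        exact hε.le_setLIntegral hμ hb hκ c (by positivity)

end

/-! ### Morrey estimates for the maximal commutator in the sup metric. -/

section

theorem setLAverage_le_mul_of_subset {X : Type*} [MeasurableSpace X] {μ : Measure X} {s t : Set X}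
    (hst : s ⊆ t) (hs : μ s ≠ 0) (ht : μ t ≠ ∞) {K : ℝ≥0∞} (hK : μ t ≤ K * μ s) (F : X → ℝ≥0∞) :
    ⨍⁻ y in s, F y ∂μ ≤ K * ⨍⁻ y in t, F y ∂μ := by
  have hs' : μ s ≠ ∞ := measure_ne_top_of_subset hst ht
  have ht0 : μ t ≠ 0 := fun h => hs (measure_mono_null hst h)
  have h1 : (μ s)⁻¹ ≤ K * (μ t)⁻¹ := by
    calc (μ s)⁻¹ = μ t * (μ t)⁻¹ * (μ s)⁻¹ := by rw [ENNReal.mul_inv_cancel ht0 ht, one_mul]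
      _ ≤ K * μ s * (μ t)⁻¹ * (μ s)⁻¹ := by gcongr
      _ = K * (μ t)⁻¹ * (μ s * (μ s)⁻¹) := by ring
      _ = _ := by rw [ENNReal.mul_inv_cancel hs hs', mul_one]
  rw [setLAverage_eq, setLAverage_eq, div_eq_mul_inv, div_eq_mul_inv]
  calc (∫⁻ y in s, F y ∂μ) * (μ s)⁻¹ ≤ (∫⁻ y in t, F y ∂μ) * (K * (μ t)⁻¹) := by gcongr
    _ = _ := by ring

theorem measurable_twistedMaximal {X : Type*} [MetricSpace X] [MeasurableSpace X]
    [OpensMeasurableSpace X] {μ : Measure X} {b : X → ℝ} (hb : Measurable b) (η : ℝ)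
    {ι : Type*} [Countable ι] (c : ι → X) (r : ι → ℝ) (g : X → ℝ≥0∞) :
    Measurable (twistedMaximal μ b η c r g) := by
  refine .iSup fun i => ?_
  exact ((measurable_expWeight b η hb).mul_const
    (⨍⁻ y in closedBall (c i) (r i), expWeight b (-η) y * g y ∂μ)).indicator
      measurableSet_closedBall

variable {n : ℕ}

theorem volume_closedBall_pi (c : Fin n → ℝ) {r : ℝ} (hr : 0 ≤ r) :
    volume (closedBall c r) = ENNReal.ofReal ((2 * r) ^ n) := by
  simpa using Real.volume_pi_closedBall c hr

theorem volume_closedBall_mul (c c' : Fin n → ℝ) {r t : ℝ} (hr : 0 ≤ r) (ht : 0 ≤ t) :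
    volume (closedBall c (t * r)) = ENNReal.ofReal t ^ n * volume (closedBall c' r) := by
  rw [volume_closedBall_pi c (by positivity), volume_closedBall_pi c' hr, ← ENNReal.ofReal_pow ht,
    ← ENNReal.ofReal_mul (by positivity), ← mul_pow]
  congr 2
  ring

theorem ballDoubling_volume : BallDoubling (volume : Measure (Fin n → ℝ)) (5 ^ n) where
  pos x r hr := measure_closedBall_pos _ x hr
  lt_top x r := measure_closedBall_lt_top
  le_mul x r hr := by
    rw [volume_closedBall_mul x x hr.le (by norm_num)]
    simp

/-- Indices of the balls with rational radius centred on a fixed countable dense set. -/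
abbrev RatBall : Type := {i : ℕ × ℚ // 0 < i.2}

/-- The centre of a rational ball. -/
def RatBall.center (n : ℕ) (i : RatBall) : Fin n → ℝ := TopologicalSpace.denseSeq _ i.1.1

/-- The radius of a rational ball. -/
def RatBall.radius (i : RatBall) : ℝ := i.1.2

theorem RatBall.radius_pos (i : RatBall) : 0 < i.radius := by
  have := i.2
  simpa [RatBall.radius] using this

theorem exists_ratBall_superset (c : Fin n → ℝ) (r : ℝ) {δ : ℝ} (hr : 0 < r) (hδ : 0 < δ) :
    ∃ i : RatBall, closedBall c r ⊆ closedBall (i.center n) i.radius ∧ i.radius ≤ r + δ := by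
  obtain ⟨k, hk⟩ := (TopologicalSpace.denseRange_denseSeq (Fin n → ℝ)).exists_dist_lt c
    (half_pos hδ)
  obtain ⟨q, hq1, hq2⟩ := exists_rat_btwn (show r + δ / 2 < r + δ by linarith)
  have hq : (0 : ℚ) < q := by
    have : (0 : ℝ) < q := by linarith
    exact_mod_cast this
  exact ⟨⟨(k, q), hq⟩, closedBall_subset_closedBall' (by
    simp only [RatBall.center, RatBall.radius]; linarith), hq2.le⟩

/-- A ball of radius `r` lies in a rational ball of radius at most `r + δ`, at the cost of a factor
`(1 + δ / r) ^ n` that tends to `1`. A countable supremum makes measurability available. -/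
theorem iSup_closedBall_eq_iSup_ratBall (F : (Fin n → ℝ) → ℝ≥0∞) (x : Fin n → ℝ) :
    ⨆ (c : Fin n → ℝ) (r : ℝ) (_ : 0 < r) (_ : x ∈ closedBall c r), ⨍⁻ y in closedBall c r, F y ∂volume =
      ⨆ i : RatBall, (closedBall (i.center n) i.radius).indicator
        (fun _ => ⨍⁻ y in closedBall (i.center n) i.radius, F y ∂volume) x := by
  apply le_antisymm
  · refine iSup_le fun c => iSup_le fun r => iSup_le fun hr => iSup_le fun hx => ?_
    set S := ⨆ i : RatBall, (closedBall (i.center n) i.radius).indicator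
        (fun _ => ⨍⁻ y in closedBall (i.center n) i.radius, F y ∂volume) x
    have key (δ : ℝ) (hδ : 0 < δ) : ⨍⁻ y in closedBall c r, F y ∂volume ≤
        ENNReal.ofReal (1 + δ / r) ^ n * S := by
      obtain ⟨i, hi, hir⟩ := exists_ratBall_superset c r hr hδ
      refine (setLAverage_le_mul_of_subset hi (measure_closedBall_pos _ c hr).ne'
        measure_closedBall_lt_top.ne (K := ENNReal.ofReal (1 + δ / r) ^ n) ?_ F).trans ?_
      · rw [← volume_closedBall_mul (i.center n) c hr.le (by positivity)]
        refine measure_mono (closedBall_subset_closedBall ?_)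
        rwa [add_mul, one_mul, div_mul_cancel₀ _ hr.ne']
      · gcongr
        refine le_trans ?_ (le_iSup _ i)
        rw [indicator_of_mem (hi hx)]
    rcases eq_or_ne S ∞ with hS | hS
    · rw [hS]; exact le_top
    have hlim : Tendsto (fun δ : ℝ => ENNReal.ofReal (1 + δ / r) ^ n * S) (𝓝[>] 0)
        (𝓝 (ENNReal.ofReal (1 + 0 / r) ^ n * S)) := by
      refine (ENNReal.Tendsto.mul_const ?_ (Or.inr hS))
      refine Tendsto.mono_left ?_ nhdsWithin_le_nhds
      refine Continuous.tendsto (f := fun δ : ℝ => ENNReal.ofReal (1 + δ / r) ^ n) ?_ 0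
      exact (ENNReal.continuous_pow n).comp (ENNReal.continuous_ofReal.comp (by fun_prop))
    simp only [zero_div, add_zero, ENNReal.ofReal_one, one_pow, one_mul] at hlim
    refine ge_of_tendsto hlim ?_
    filter_upwards [self_mem_nhdsWithin] with δ hδ using key δ hδ
  · refine iSup_le fun i => ?_
    by_cases hx : x ∈ closedBall (i.center n) i.radius
    · rw [indicator_of_mem hx]
      exact le_iSup_of_le _ (le_iSup_of_le _ (le_iSup_of_le i.radius_pos (le_iSup_of_le hx le_rfl)))
    · rw [indicator_of_notMem hx]
      exact zero_le

variable {b : (Fin n → ℝ) → ℝ} {A ε p lam η : ℝ}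

/-- On a ball, the twisted maximal function is controlled by its action on the part of the function
living on the enlarged ball and by the averages over the concentric enlargements. -/
theorem twistedMaximal_le_add (g : (Fin n → ℝ) → ℝ≥0∞) {c x : Fin n → ℝ} {r : ℝ} (hr : 0 < r)
    (hx : x ∈ closedBall c r) :
    twistedMaximal volume b η (RatBall.center n) RatBall.radius g x ≤
      twistedMaximal volume b η (RatBall.center n) RatBall.radius
        ((closedBall c (5 * r)).indicator g) x + 15 ^ n * (expWeight b η x *
          ⨆ k : ℕ, ⨍⁻ y in closedBall c (5 ^ k * r), expWeight b (-η) y * g y ∂volume) := by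
  refine iSup_le fun i => ?_
  set Q := closedBall (i.center n) i.radius with hQ
  by_cases hxQ : x ∈ Q
  swap
  · rw [indicator_of_notMem hxQ]
    exact zero_le
  by_cases hsub : Q ⊆ closedBall c (5 * r)
  · refine le_trans ?_ le_self_add
    refine le_trans (le_of_eq ?_) (le_iSup _ i)
    rw [indicator_of_mem hxQ, indicator_of_mem hxQ, setLAverage_eq, setLAverage_eq]
    congr 2
    refine setLIntegral_congr_fun measurableSet_closedBall fun y hy => ?_
    rw [indicator_of_mem (hsub hy)]
  · refine le_trans ?_ le_add_self
    rw [indicator_of_mem hxQ]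
    obtain ⟨y, hyQ, hy⟩ := not_subset.1 hsub
    have hρ := i.radius_pos
    set ρ := i.radius
    have h1 : 5 * r < dist y c := by simpa using hy
    have h2 := mem_closedBall.1 hx
    have h3 := mem_closedBall.1 hxQ
    have h4 := mem_closedBall.1 hyQ
    have h5 : dist y c ≤ dist y (i.center n) + dist x (i.center n) + dist x c := by
      have := dist_triangle y (i.center n) c
      have := dist_triangle (i.center n) x c
      rw [dist_comm (i.center n) x] at this
      linarith
    -- A ball that meets `B` and leaves `5B` has `ρ > 2 * r`, hence lies within distance `2 * ρ + r
    -- ≤ 3 * ρ` of `c`. Rounding `3 * ρ / r` up to a power of `5` costs at most a factor `5`, so the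
    -- radii have ratio at most `15`.
    obtain ⟨k, hk1, hk2⟩ := exists_nat_pow_near (x := 3 * ρ / r) (y := 5)
      (by rw [le_div_iff₀ hr]; linarith) (by norm_num)
    rw [le_div_iff₀ hr] at hk1
    rw [div_lt_iff₀ hr] at hk2
    rw [mul_left_comm]
    gcongr
    refine (setLAverage_le_mul_of_subset (t := closedBall c (5 ^ (k + 1) * r)) ?_
      (measure_closedBall_pos _ _ hρ).ne' measure_closedBall_lt_top.ne (K := 15 ^ n) ?_ _).trans ?_
    · refine closedBall_subset_closedBall' ?_
      have := dist_triangle (i.center n) x c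
      rw [dist_comm (i.center n) x] at this
      linarith
    · have := volume_closedBall_mul c (i.center n) hρ.le (t := 15) (by norm_num)
      rw [ENNReal.ofReal_ofNat] at this
      rw [← this]
      refine measure_mono (closedBall_subset_closedBall ?_)
      rw [pow_succ]
      linarith
    · gcongr
      exact le_iSup (fun k : ℕ => ⨍⁻ y in closedBall c (5 ^ k * r), expWeight b (-η) y * g y ∂volume) (k + 1)

/-- The estimate for the far part, uniform in `k`: the `A_p` comparison turns the average into the
integral of `g ^ p` over the dilate divided by its weighted mass, and that mass exceeds the mass of
the original ball by enough to compensate the Morrey growth. -/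
theorem ExpMeanOscillation.expMeasure_mul_setLAverage_rpow_le
    (hε : ExpMeanOscillation volume b ε) (hb : MeanOscillationLE volume b A) (hp : 1 < p)
    (hη : |η| * p ≤ ε) (hη' : |η| * p / ((p - 1) / 2) ≤ ε)
    (hηlam : |η| * p * (A * 5 ^ n) ≤ lam * Real.log 5)
    {g : (Fin n → ℝ) → ℝ≥0∞} (hg : Measurable g) {N : ℝ≥0∞}
    (hN : ∀ c r, 0 < r → ∫⁻ y in closedBall c r, g y ^ p ≤ ENNReal.ofReal (r ^ (n - lam)) * N)
    (c : Fin n → ℝ) {r : ℝ} (hr : 0 < r) (k : ℕ) :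
    expMeasure volume b (η * p) (closedBall c r) *
      (⨍⁻ y in closedBall c (5 ^ k * r), expWeight b (-η) y * g y ∂volume) ^ p ≤
        7 ^ (p + 1) * (ENNReal.ofReal (r ^ (n - lam)) * N) := by
  have hbm := hb.measurable
  have hμ := ballDoubling_volume (n := n)
  have hp0 : 0 < p := by linarith
  have hκ : |η * p| ≤ ε := by rwa [abs_mul, abs_of_pos hp0]
  have hκs : |η * p| / (p - 1) ≤ ε := by
    refine le_trans ?_ hη'
    rw [abs_mul, abs_of_pos hp0]
    gcongr
    linarith
  have hrk : 0 < 5 ^ k * r := by positivity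
  set ν := expMeasure volume b (η * p) with hν
  set Bk := closedBall c (5 ^ k * r)
  have hνd := hε.ballDoubling hμ hb hκ
  have hνk0 : ν Bk ≠ 0 := (hνd.pos c _ hrk).ne'
  have hνk : ν Bk ≠ ∞ := (hνd.lt_top c _).ne
  have hF : Measurable fun y => expWeight b (-η) y * g y := (measurable_expWeight b _ hbm).mul hg
  have hI : ∫⁻ y in Bk, (expWeight b (-η) y * g y) ^ p ∂ν = ∫⁻ y in Bk, g y ^ p := by
    rw [hν, expMeasure, setLIntegral_withDensity_eq_setLIntegral_mul _
          (measurable_expWeight b _ hbm) (hF.pow_const p) measurableSet_closedBall]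
    refine lintegral_congr fun y => ?_
    simp only [Pi.mul_apply]
    rw [ENNReal.mul_rpow_of_nonneg _ _ hp0.le, expWeight_rpow, ← mul_assoc, expWeight_mul]
    ring_nf
    rw [expWeight_zero, one_mul]
  have hav : (⨍⁻ y in Bk, expWeight b (-η) y * g y ∂volume) ^ p ≤
      7 ^ p * ((∫⁻ y in Bk, g y ^ p) * (ν Bk)⁻¹) := by
    have h := ENNReal.rpow_le_rpow (hε.setLAverage_le hμ hb hp hκ hκs c hrk hF) hp0.le
    rw [← div_eq_mul_inv, ← hI, ← setLAverage_eq]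
    rwa [ENNReal.mul_rpow_of_nonneg _ _ hp0.le, ← ENNReal.rpow_mul, inv_mul_cancel₀ hp0.ne',
      ENNReal.rpow_one] at h
  set E : ℝ≥0∞ := ENNReal.ofReal (Real.exp (|η * p| * (k * (A * 5 ^ n)))) with hE
  have hmass : ν (closedBall c r) * 5 ^ (k * n) ≤ 7 * E * ν Bk := by
    have h := hε.expMeasure_mul_le hμ hb hκ c hr k
    rw [volume_closedBall_mul c c hr.le (by positivity)] at h
    have hB0 : volume (closedBall c r) ≠ 0 := (hμ.pos c r hr).ne'
    have hB := (hμ.lt_top c r).ne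
    rw [← ENNReal.mul_le_mul_iff_left hB0 hB]
    convert h using 1
    · rw [ENNReal.ofReal_pow (by norm_num), ENNReal.ofReal_ofNat, pow_mul]
      ring
    · rw [hE]
      push_cast
      ring
  -- After cancelling `5 ^ (k * n)` this says that the drift `E` is at most `5 ^ (k * lam)`, which
  -- is `hηlam` multiplied by `k` and exponentiated.
  have hdecay : E * ENNReal.ofReal ((5 ^ k * r) ^ (n - lam)) ≤
      5 ^ (k * n) * ENNReal.ofReal (r ^ (n - lam)) := by
    rw [hE, ← ENNReal.ofReal_mul (Real.exp_pos _).le, ← ENNReal.ofReal_ofNat,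
      ← ENNReal.ofReal_pow (by norm_num), ← ENNReal.ofReal_mul (by positivity)]
    refine ENNReal.ofReal_le_ofReal ?_
    rw [Real.mul_rpow (by positivity) hr.le, ← mul_assoc]
    gcongr
    rw [← Real.rpow_natCast 5 k, ← Real.rpow_natCast 5 (k * n), ← Real.rpow_mul (by norm_num),
      Real.rpow_def_of_pos (by norm_num), Real.rpow_def_of_pos (by norm_num), ← Real.exp_add]
    refine Real.exp_le_exp.2 ?_
    rw [abs_mul, abs_of_pos hp0]
    push_cast
    have := mul_le_mul_of_nonneg_left hηlam (Nat.cast_nonneg (α := ℝ) k)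
    linarith
  calc _ ≤ ν (closedBall c r) * (7 ^ p * ((ENNReal.ofReal ((5 ^ k * r) ^ (n - lam)) * N) *
        (ν Bk)⁻¹)) := by
        gcongr
        refine hav.trans ?_
        gcongr
        exact hN c _ hrk
    _ = ν (closedBall c r) * 5 ^ (k * n) * (5 ^ (k * n))⁻¹ * (7 ^ p *
          ((ENNReal.ofReal ((5 ^ k * r) ^ (n - lam)) * N) * (ν Bk)⁻¹)) := by
        rw [mul_assoc (ν (closedBall c r)), ENNReal.mul_inv_cancel (by simp) (by finiteness),
          mul_one]
    _ ≤ 7 * E * ν Bk * (5 ^ (k * n))⁻¹ * (7 ^ p *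
          ((ENNReal.ofReal ((5 ^ k * r) ^ (n - lam)) * N) * (ν Bk)⁻¹)) := by
        gcongr
    _ = 7 ^ p * 7 * (E * ENNReal.ofReal ((5 ^ k * r) ^ (n - lam))) * N * (5 ^ (k * n))⁻¹ *
          (ν Bk * (ν Bk)⁻¹) := by ring
    _ ≤ 7 ^ p * 7 * (5 ^ (k * n) * ENNReal.ofReal (r ^ (n - lam))) * N * (5 ^ (k * n))⁻¹ *
          (ν Bk * (ν Bk)⁻¹) := by gcongr
    _ = 7 ^ p * 7 * ENNReal.ofReal (r ^ (n - lam)) * N * (5 ^ (k * n) * (5 ^ (k * n))⁻¹) *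
          (ν Bk * (ν Bk)⁻¹) := by ring
    _ = _ := by
        rw [ENNReal.mul_inv_cancel hνk0 hνk, ENNReal.mul_inv_cancel (by simp) (by finiteness),
          ENNReal.rpow_add _ _ (by norm_num) (by norm_num), ENNReal.rpow_one]
        ring

/-- Morrey bound for the twisted maximal function. -/
theorem ExpMeanOscillation.exists_setLIntegral_twistedMaximal_le
    (hε : ExpMeanOscillation volume b ε) (hb : MeanOscillationLE volume b A) (hp : 1 < p)
    (hη : |η| * p ≤ ε) (hη' : |η| * p / ((p - 1) / 2) ≤ ε)
    (hηlam : |η| * p * (A * 5 ^ n) ≤ lam * Real.log 5) :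
    ∃ C : ℝ≥0∞, C ≠ ∞ ∧ ∀ g : (Fin n → ℝ) → ℝ≥0∞, Measurable g → ∀ N : ℝ≥0∞,
      (∀ c r, 0 < r → ∫⁻ y in closedBall c r, g y ^ p ≤ ENNReal.ofReal (r ^ (n - lam)) * N) →
      ∀ c r, 0 < r → ∫⁻ x in closedBall c r,
        twistedMaximal volume b η (RatBall.center n) RatBall.radius g x ^ p ≤
          C * (ENNReal.ofReal (r ^ (n - lam)) * N) := by
  have hbm := hb.measurable
  have hp0 : 0 < p := by linarith
  obtain ⟨C, hC, hCg⟩ := hε.lintegral_twistedMaximal_le ballDoubling_volume hb hp hη hη'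
    (RatBall.center n) RatBall.radius RatBall.radius_pos
  refine ⟨2 ^ (p - 1) * (C * ENNReal.ofReal (5 ^ (n - lam)) + (15 ^ n) ^ p * 7 ^ (p + 1)), ?_, ?_⟩
  · have h1 : (2 : ℝ≥0∞) ^ (p - 1) ≠ ∞ := ENNReal.rpow_ne_top_of_nonneg (by linarith) (by simp)
    have h2 : ((15 : ℝ≥0∞) ^ n) ^ p ≠ ∞ := ENNReal.rpow_ne_top_of_nonneg hp0.le (by finiteness)
    have h3 : (7 : ℝ≥0∞) ^ (p + 1) ≠ ∞ := ENNReal.rpow_ne_top_of_nonneg (by linarith) (by simp)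
    finiteness
  intro g hg N hN c r hr
  set ν := expMeasure volume b (η * p) with hν
  set S : ℝ≥0∞ := ⨆ k : ℕ, ⨍⁻ y in closedBall c (5 ^ k * r), expWeight b (-η) y * g y ∂volume with hS
  set g₁ := (closedBall c (5 * r)).indicator g with hg₁
  have hg₁m : Measurable g₁ := hg.indicator measurableSet_closedBall
  have hlocal : ∫⁻ x, twistedMaximal volume b η (RatBall.center n) RatBall.radius g₁ x ^ p ≤
      C * ENNReal.ofReal (5 ^ (n - lam)) * (ENNReal.ofReal (r ^ (n - lam)) * N) := by
    refine (hCg g₁ hg₁m).trans ?_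
    have : ∫⁻ x, g₁ x ^ p = ∫⁻ x in closedBall c (5 * r), g x ^ p := by
      rw [← lintegral_indicator measurableSet_closedBall]
      refine lintegral_congr fun x => ?_
      by_cases hx : x ∈ closedBall c (5 * r)
      · rw [hg₁, indicator_of_mem hx, indicator_of_mem hx]
      · rw [hg₁, indicator_of_notMem hx, indicator_of_notMem hx, ENNReal.zero_rpow_of_pos hp0]
    rw [this, mul_assoc, ← mul_assoc (ENNReal.ofReal _), ← ENNReal.ofReal_mul (by positivity),
      ← Real.mul_rpow (by norm_num) hr.le]
    gcongr
    exact hN c _ (by positivity)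
  have hglobal : ν (closedBall c r) * S ^ p ≤
      7 ^ (p + 1) * (ENNReal.ofReal (r ^ (n - lam)) * N) := by
    -- The scales enter through a supremum, not a sum, so a bound uniform in `k` is enough.
    have : S ^ p = ⨆ k : ℕ, (⨍⁻ y in closedBall c (5 ^ k * r), expWeight b (-η) y * g y ∂volume) ^ p :=
      (ENNReal.orderIsoRpow p hp0).map_iSup _
    rw [this, ENNReal.mul_iSup]
    exact iSup_le fun k => hε.expMeasure_mul_setLAverage_rpow_le hb hp hη hη' hηlam hg hN c hr k
  calc ∫⁻ x in closedBall c r,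
        twistedMaximal volume b η (RatBall.center n) RatBall.radius g x ^ p
      ≤ ∫⁻ x in closedBall c r, 2 ^ (p - 1) *
          (twistedMaximal volume b η (RatBall.center n) RatBall.radius g₁ x ^ p +
            ((15 ^ n) ^ p * S ^ p) * expWeight b (η * p) x) := by
        refine setLIntegral_mono' measurableSet_closedBall fun x hx => ?_
        refine (ENNReal.rpow_le_rpow (twistedMaximal_le_add g hr hx) hp0.le).trans ?_
        refine (ENNReal.rpow_add_le_mul_rpow_add_rpow _ _ hp.le).trans (le_of_eq ?_)
        rw [ENNReal.mul_rpow_of_nonneg _ _ hp0.le, ENNReal.mul_rpow_of_nonneg _ _ hp0.le,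
          expWeight_rpow]
        ring
    _ = 2 ^ (p - 1) * ((∫⁻ x in closedBall c r,
          twistedMaximal volume b η (RatBall.center n) RatBall.radius g₁ x ^ p) +
            (15 ^ n) ^ p * (ν (closedBall c r) * S ^ p)) := by
        rw [lintegral_const_mul' _ _ (ENNReal.rpow_ne_top_of_nonneg (by linarith) (by simp)),
          lintegral_add_right _ ((measurable_expWeight b _ hbm).const_mul _),
          lintegral_const_mul _ (measurable_expWeight b _ hbm), hν, expMeasure_closedBall]
        ring
    _ ≤ 2 ^ (p - 1) * (C * ENNReal.ofReal (5 ^ (n - lam)) * (ENNReal.ofReal (r ^ (n - lam)) * N) +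
            (15 ^ n) ^ p * (7 ^ (p + 1) * (ENNReal.ofReal (r ^ (n - lam)) * N))) := by
        gcongr
        exact (setLIntegral_le_lintegral _ _).trans hlocal
    _ = _ := by ring

/-- The maximal commutator along the rational balls. -/
def ratCommutator (b : (Fin n → ℝ) → ℝ) (g : (Fin n → ℝ) → ℝ≥0∞) (x : Fin n → ℝ) : ℝ≥0∞ :=
  ⨆ i : RatBall, (closedBall (i.center n) i.radius).indicator
    (fun _ => ⨍⁻ y in closedBall (i.center n) i.radius, ‖b x - b y‖ₑ * g y ∂volume) x

theorem ratCommutator_le (hb : Measurable b) {g : (Fin n → ℝ) → ℝ≥0∞} (hg : Measurable g)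
    (hη : 0 < η) (x : Fin n → ℝ) :
    ratCommutator b g x ≤ ENNReal.ofReal η⁻¹ *
      (twistedMaximal volume b η (RatBall.center n) RatBall.radius g x +
        twistedMaximal volume b (-η) (RatBall.center n) RatBall.radius g x) := by
  refine iSup_le fun i => ?_
  by_cases hx : x ∈ closedBall (i.center n) i.radius
  swap
  · rw [indicator_of_notMem hx]
    exact zero_le
  rw [indicator_of_mem hx]
  have h1 := le_iSup (fun i : RatBall => (closedBall (i.center n) i.radius).indicator (fun _ =>
    expWeight b η x * ⨍⁻ y in closedBall (i.center n) i.radius, expWeight b (-η) y * g y ∂volume) x) i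
  have h2 := le_iSup (fun i : RatBall => (closedBall (i.center n) i.radius).indicator (fun _ =>
    expWeight b (-η) x *
      ⨍⁻ y in closedBall (i.center n) i.radius, expWeight b (- -η) y * g y ∂volume) x) i
  simp only [indicator_of_mem hx] at h1 h2
  refine le_trans ?_ (mul_le_mul_right (add_le_add h1 h2) _)
  rw [setLAverage_eq, setLAverage_eq, setLAverage_eq, neg_neg]
  simp only [div_eq_mul_inv]
  have hm (κ : ℝ) : Measurable fun y => expWeight b κ y * g y := (measurable_expWeight b κ hb).mul hg
  calc _ ≤ (∫⁻ y in closedBall (i.center n) i.radius, ENNReal.ofReal η⁻¹ *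
        (expWeight b η x * (expWeight b (-η) y * g y) +
          expWeight b (-η) x * (expWeight b η y * g y))) *
            (volume (closedBall (i.center n) i.radius))⁻¹ := by
        refine mul_le_mul_left (lintegral_mono fun y => ?_) _
        refine (mul_le_mul_left (enorm_sub_le_expWeight b x hη y) _).trans (le_of_eq ?_)
        ring
    _ = _ := by
        rw [lintegral_const_mul' _ _ ENNReal.ofReal_ne_top,
          lintegral_add_left ((hm _).const_mul _), lintegral_const_mul _ (hm _),
          lintegral_const_mul _ (hm _)]
        ring

/-- Functions of bounded mean oscillation have maximal commutators bounded on Morrey spaces. -/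
theorem MeanOscillationLE.exists_setLIntegral_ratCommutator_le
    (hb : MeanOscillationLE volume b A) (hA : 0 < A) (hp : 1 < p) (hlam : 0 < lam) :
    ∃ C : ℝ≥0∞, C ≠ ∞ ∧ ∀ g : (Fin n → ℝ) → ℝ≥0∞, Measurable g → ∀ N : ℝ≥0∞,
      (∀ c r, 0 < r → ∫⁻ y in closedBall c r, g y ^ p ≤ ENNReal.ofReal (r ^ (n - lam)) * N) →
      ∀ c r, 0 < r → ∫⁻ x in closedBall c r, ratCommutator b g x ^ p ≤
          C * (ENNReal.ofReal (r ^ (n - lam)) * N) := by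
  have hbm := hb.measurable
  have hp0 : 0 < p := by linarith
  have hp1 : 0 < (p - 1) / 2 := by linarith
  obtain ⟨ε, hε0, hε⟩ := hb.exists_lintegral_exp_le ballDoubling_volume hA
  have hlog : 0 < Real.log 5 := Real.log_pos (by norm_num)
  -- The three entries ensure, in order, exponential integrability of the weight, that of its dual
  -- weight, and a drift slower than the decay `5 ^ (-k * lam)`. The last entry is positive because
  -- `lam` is.
  set η : ℝ := min (ε / p) (min (ε * ((p - 1) / 2) / p) (lam * Real.log 5 / (p * (A * 5 ^ n))))
    with hη
  have hη0 : 0 < η := by positivity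
  have h1 : η * p ≤ ε := by
    rw [← le_div_iff₀ hp0]; exact min_le_left _ _
  have h2 : η * p / ((p - 1) / 2) ≤ ε := by
    rw [div_le_iff₀ hp1, ← le_div_iff₀ hp0]
    exact (min_le_right _ _).trans (min_le_left _ _)
  have h3 : η * p * (A * 5 ^ n) ≤ lam * Real.log 5 := by
    rw [mul_assoc, ← le_div_iff₀ (by positivity)]
    exact (min_le_right _ _).trans (min_le_right _ _)
  obtain ⟨C₁, hC₁, hg₁⟩ := ExpMeanOscillation.exists_setLIntegral_twistedMaximal_le hε hb hp
    (η := η) (lam := lam) (by rwa [abs_of_pos hη0]) (by rwa [abs_of_pos hη0])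
    (by rwa [abs_of_pos hη0])
  obtain ⟨C₂, hC₂, hg₂⟩ := ExpMeanOscillation.exists_setLIntegral_twistedMaximal_le hε hb hp
    (η := -η) (lam := lam) (by rwa [abs_neg, abs_of_pos hη0]) (by rwa [abs_neg, abs_of_pos hη0])
    (by rwa [abs_neg, abs_of_pos hη0])
  have hK : ENNReal.ofReal η⁻¹ ^ p * 2 ^ (p - 1) ≠ ∞ := ENNReal.mul_ne_top
    (ENNReal.rpow_ne_top_of_nonneg hp0.le (by simp))
    (ENNReal.rpow_ne_top_of_nonneg (by linarith) (by simp))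
  refine ⟨ENNReal.ofReal η⁻¹ ^ p * 2 ^ (p - 1) * (C₁ + C₂), by finiteness, ?_⟩
  intro g hg N hN c r hr
  calc ∫⁻ x in closedBall c r, ratCommutator b g x ^ p
      ≤ ∫⁻ x in closedBall c r, (ENNReal.ofReal η⁻¹ ^ p * 2 ^ (p - 1)) *
        (twistedMaximal volume b η (RatBall.center n) RatBall.radius g x ^ p +
          twistedMaximal volume b (-η) (RatBall.center n) RatBall.radius g x ^ p) := by
        refine lintegral_mono fun x => ?_
        refine (ENNReal.rpow_le_rpow (ratCommutator_le hbm hg hη0 x) hp0.le).trans ?_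
        rw [ENNReal.mul_rpow_of_nonneg _ _ hp0.le, mul_assoc]
        gcongr
        exact ENNReal.rpow_add_le_mul_rpow_add_rpow _ _ hp.le
    _ = (ENNReal.ofReal η⁻¹ ^ p * 2 ^ (p - 1)) * ((∫⁻ x in closedBall c r,
        twistedMaximal volume b η (RatBall.center n) RatBall.radius g x ^ p) +
          ∫⁻ x in closedBall c r,
            twistedMaximal volume b (-η) (RatBall.center n) RatBall.radius g x ^ p) := by
        rw [lintegral_const_mul' _ _ hK, lintegral_add_left]
        exact (measurable_twistedMaximal hbm _ _ _ _).pow_const _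
    _ ≤ (ENNReal.ofReal η⁻¹ ^ p * 2 ^ (p - 1)) * (C₁ * (ENNReal.ofReal (r ^ (n - lam)) * N) +
          C₂ * (ENNReal.ofReal (r ^ (n - lam)) * N)) := by
        gcongr
        · exact hg₁ g hg N hN c r hr
        · exact hg₂ g hg N hN c r hr
    _ = _ := by ring

end

/-! ### Transfer between Euclidean space and sup-metric coordinates. -/

section

variable {n : ℕ}

theorem measurableEmbedding_toLp :
    MeasurableEmbedding (WithLp.toLp 2 : (Fin n → ℝ) → Rn n) :=
  (MeasurableEquiv.toLp 2 (Fin n → ℝ)).measurableEmbedding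

/-- The centre of a cube, in plain coordinates. -/
def cubeCenter (a : Rn n) (l : ℝ) : Fin n → ℝ := fun i => a i + l / 2

theorem toLp_preimage_cube (a : Rn n) {l : ℝ} (hl : 0 ≤ l) :
    WithLp.toLp 2 ⁻¹' cube a l = closedBall (cubeCenter a l) (l / 2) := by
  ext y
  rw [mem_closedBall, dist_pi_le_iff (by positivity)]
  simp only [cube, mem_preimage, mem_ofPred_eq, mem_Icc, Real.dist_eq, abs_le, cubeCenter]
  refine forall_congr' fun i => ⟨fun h => ⟨by linarith [h.1], by linarith [h.2]⟩,
    fun h => ⟨by linarith [h.1], by linarith [h.2]⟩⟩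

theorem mem_cube_iff (a x : Rn n) {l : ℝ} (hl : 0 ≤ l) :
    x ∈ cube a l ↔ WithLp.ofLp x ∈ closedBall (cubeCenter a l) (l / 2) := by
  rw [← toLp_preimage_cube a hl]
  rfl

theorem exists_cubeCenter_eq (c : Fin n → ℝ) (r : ℝ) :
    ∃ a : Rn n, cubeCenter a (2 * r) = c := by
  refine ⟨WithLp.toLp 2 fun i => c i - r, ?_⟩
  funext i
  simp only [cubeCenter]
  ring

theorem measurableSet_cube (a : Rn n) (l : ℝ) : MeasurableSet (cube a l) := by
  have : cube a l = ⋂ i, {y : Rn n | y i ∈ Icc (a i) (a i + l)} := by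
    ext y; simp [cube]
  rw [this]
  refine MeasurableSet.iInter fun i => ?_
  have hm : Measurable fun y : Rn n => y i := by fun_prop
  exact hm measurableSet_Icc

theorem setLIntegral_cube (F : Rn n → ℝ≥0∞) (a : Rn n) {l : ℝ} (hl : 0 ≤ l) :
    ∫⁻ y in cube a l, F y = ∫⁻ z in closedBall (cubeCenter a l) (l / 2), F (WithLp.toLp 2 z) := by
  rw [← toLp_preimage_cube a hl, (PiLp.volume_preserving_toLp _).setLIntegral_comp_preimage_emb
    measurableEmbedding_toLp]

theorem volume_cube (a : Rn n) {l : ℝ} (hl : 0 ≤ l) :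
    volume (cube a l) = ENNReal.ofReal (l ^ n) := by
  rw [← (PiLp.volume_preserving_toLp _).measure_preimage_emb measurableEmbedding_toLp,
    toLp_preimage_cube a hl, volume_closedBall_pi _ (by positivity)]
  congr 2
  ring

theorem volume_cube_eq_closedBall (a : Rn n) {l : ℝ} (hl : 0 ≤ l) :
    volume (cube a l) = volume (closedBall (cubeCenter a l) (l / 2)) := by
  rw [← toLp_preimage_cube a hl,
    (PiLp.volume_preserving_toLp _).measure_preimage_emb measurableEmbedding_toLp]

theorem volume_cube_pos (a : Rn n) {l : ℝ} (hl : 0 < l) : volume (cube a l) ≠ 0 := by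
  rw [volume_cube a hl.le]
  simp only [ne_eq, ENNReal.ofReal_eq_zero, not_le]
  positivity

theorem volume_cube_ne_top (a : Rn n) {l : ℝ} (hl : 0 ≤ l) : volume (cube a l) ≠ ∞ := by
  rw [volume_cube a hl]
  exact ENNReal.ofReal_ne_top

theorem setLAverage_cube (F : Rn n → ℝ≥0∞) (a : Rn n) {l : ℝ} (hl : 0 ≤ l) :
    ⨍⁻ y in cube a l, F y ∂volume =
      ⨍⁻ z in closedBall (cubeCenter a l) (l / 2), F (WithLp.toLp 2 z) ∂volume := by
  rw [setLAverage_eq, setLAverage_eq, setLIntegral_cube F a hl, volume_cube_eq_closedBall a hl]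

theorem setAverage_cube (b : Rn n → ℝ) (a : Rn n) {l : ℝ} (hl : 0 ≤ l) :
    ⨍ y in cube a l, b y ∂volume =
      ballMean volume (fun z => b (WithLp.toLp 2 z)) (cubeCenter a l) (l / 2) := by
  rw [ballMean, setAverage_eq, setAverage_eq, measureReal_def, measureReal_def,
    volume_cube_eq_closedBall a hl, ← toLp_preimage_cube a hl,
    (PiLp.volume_preserving_toLp _).setIntegral_preimage_emb measurableEmbedding_toLp]

/-- The factor `n + 1` in place of `√n` gives a strict inequality, as needed for open balls. -/
theorem dist_lt_of_forall_abs_sub_le {x y : Rn n} {r : ℝ} (hr : 0 < r)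
    (h : ∀ i, |x i - y i| ≤ r) : dist x y < (n + 1) * r := by
  rw [EuclideanSpace.dist_eq, Real.sqrt_lt' (by positivity)]
  calc ∑ i, dist (x i) (y i) ^ 2 ≤ ∑ _i : Fin n, r ^ 2 := by
        gcongr with i
        exact h i
    _ = n * r ^ 2 := by simp
    _ < ((n + 1) * r) ^ 2 := by
        have : 0 < r ^ 2 := by positivity
        nlinarith [(Nat.cast_nonneg n : (0 : ℝ) ≤ n)]

theorem cube_subset_ball (a : Rn n) {l : ℝ} (hl : 0 < l) : cube a l ⊆ ball a ((n + 1) * l) := by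
  intro y hy
  refine dist_lt_of_forall_abs_sub_le hl fun i => ?_
  have := hy i
  rw [abs_le]
  constructor <;> linarith [this.1, this.2]

theorem closedBall_subset_toLp_preimage_ball (c : Fin n → ℝ) {r : ℝ} (hr : 0 < r) :
    closedBall c r ⊆ WithLp.toLp 2 ⁻¹' ball (WithLp.toLp 2 c : Rn n) ((n + 1) * r) := by
  intro y hy
  refine dist_lt_of_forall_abs_sub_le hr fun i => ?_
  exact (dist_pi_le_iff hr.le).1 hy i

theorem toLp_preimage_ball_subset (x : Rn n) {r : ℝ} (hr : 0 < r) :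
    WithLp.toLp 2 ⁻¹' ball x r ⊆ closedBall (WithLp.ofLp x) r := by
  intro y hy
  refine (dist_pi_le_iff hr.le).2 fun i => ?_
  have h1 := PiLp.norm_apply_le (WithLp.toLp 2 y - x) i
  have h2 : dist (WithLp.toLp 2 y) x < r := hy
  rw [dist_eq_norm] at h2
  exact h1.trans h2.le

/-- The maximal commutator is a supremum over countably many cubes. -/
theorem maximalCommutator_eq_ratCommutator (b f : Rn n → ℝ) (x : Rn n) :
    maximalCommutator b f x = ratCommutator (fun z => b (WithLp.toLp 2 z))
      (fun z => ‖f (WithLp.toLp 2 z)‖ₑ) (WithLp.ofLp x) := by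
  unfold ratCommutator
  rw [← iSup_closedBall_eq_iSup_ratBall
    (fun z => ‖b x - b (WithLp.toLp 2 z)‖ₑ * ‖f (WithLp.toLp 2 z)‖ₑ)]
  apply le_antisymm
  · refine iSup_le fun a => iSup_le fun l => iSup_le fun hl => iSup_le fun hx => ?_
    rw [setLAverage_cube _ a hl.le]
    exact le_iSup_of_le _ (le_iSup_of_le _ (le_iSup_of_le (half_pos hl)
      (le_iSup_of_le ((mem_cube_iff a x hl.le).1 hx) le_rfl)))
  · refine iSup_le fun c => iSup_le fun r => iSup_le fun hr => iSup_le fun hx => ?_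
    obtain ⟨a, rfl⟩ := exists_cubeCenter_eq c r
    have hr2 : 2 * r / 2 = r := by ring
    have hav := setLAverage_cube (fun y => ‖b x - b y‖ₑ * ‖f y‖ₑ) a (l := 2 * r) (by positivity)
    rw [hr2] at hav
    rw [← hav]
    refine le_iSup_of_le a (le_iSup_of_le (2 * r) (le_iSup_of_le (by positivity)
      (le_iSup_of_le ((mem_cube_iff a x (by positivity)).2 ?_) le_rfl)))
    rwa [hr2]

theorem measurable_ratCommutator {b : (Fin n → ℝ) → ℝ} (hb : Measurable b)
    {g : (Fin n → ℝ) → ℝ≥0∞} (hg : Measurable g) : Measurable (ratCommutator b g) := by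
  refine .iSup fun i => ?_
  simp only [setLAverage_eq]
  have h : Measurable fun z : (Fin n → ℝ) × (Fin n → ℝ) => ‖b z.1 - b z.2‖ₑ * g z.2 := by
    fun_prop
  exact ((h.lintegral_prod_right' (ν := volume.restrict
    (closedBall (i.center n) i.radius))).div_const
      (volume (closedBall (i.center n) i.radius))).indicator measurableSet_closedBall

theorem measurable_maximalCommutator {b f : Rn n → ℝ} (hb : Measurable b) (hf : Measurable f) :
    Measurable (maximalCommutator b f) := by
  have h : maximalCommutator b f = fun x => ratCommutator (fun z => b (WithLp.toLp 2 z))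
      (fun z => ‖f (WithLp.toLp 2 z)‖ₑ) (WithLp.ofLp x) :=
    funext fun x => maximalCommutator_eq_ratCommutator b f x
  rw [h]
  have ht : Measurable (WithLp.toLp 2 : (Fin n → ℝ) → Rn n) := measurableEmbedding_toLp.measurable
  have ho : Measurable (WithLp.ofLp : Rn n → (Fin n → ℝ)) :=
    (MeasurableEquiv.toLp 2 (Fin n → ℝ)).symm.measurable
  exact (measurable_ratCommutator (hb.comp ht) (hf.comp ht).enorm).comp ho

/-- Changing `f` on a null set has no effect at all, while the pointwise value `b x` limits the
conclusion to almost every `x`. This permits passing to Borel representatives. -/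
theorem maximalCommutator_congr_ae {b b' f f' : Rn n → ℝ} (hb : b =ᵐ[volume] b')
    (hf : f =ᵐ[volume] f') : maximalCommutator b f =ᵐ[volume] maximalCommutator b' f' := by
  filter_upwards [hb] with x hx
  unfold maximalCommutator
  refine iSup_congr fun a => iSup_congr fun l => iSup_congr fun _ => iSup_congr fun _ => ?_
  refine laverage_congr (ae_restrict_of_ae ?_)
  filter_upwards [hb, hf] with y hy hy'
  rw [hx, hy, hy']

theorem bmoSeminorm_congr_ae {b b' : Rn n → ℝ} (h : b =ᵐ[volume] b') :
    bmoSeminorm b = bmoSeminorm b' := by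
  unfold bmoSeminorm
  refine iSup_congr fun a => iSup_congr fun l => iSup_congr fun _ => ?_
  rw [average_congr (ae_restrict_of_ae h)]
  refine laverage_congr (ae_restrict_of_ae ?_)
  filter_upwards [h] with y hy
  rw [hy]

theorem MemBMO.congr_ae {b b' : Rn n → ℝ} (hb : MemBMO b) (h : b =ᵐ[volume] b') : MemBMO b' :=
  ⟨hb.1.congr h, bmoSeminorm_congr_ae h ▸ hb.2⟩

section Morrey

variable {ε : Type*} [ENorm ε] {p : ℝ≥0∞} {lam : ℝ}

theorem eLpNorm_ball_le (f : Rn n → ε) (x : Rn n) {r : ℝ} (hr : 0 < r) :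
    eLpNorm f p (volume.restrict (ball x r)) ≤
      ENNReal.ofReal (r ^ ((n - lam) / p.toReal)) * morreyNorm p lam f := by
  have h : ENNReal.ofReal (r ^ ((lam - n) / p.toReal)) *
      eLpNorm f p (volume.restrict (ball x r)) ≤ morreyNorm p lam f :=
    le_iSup_of_le x (le_iSup_of_le r (le_iSup_of_le hr le_rfl))
  refine le_trans (le_of_eq ?_) (mul_le_mul_right h _)
  rw [← mul_assoc, ← ENNReal.ofReal_mul (by positivity), ← Real.rpow_add hr, ← add_div]
  simp

theorem morreyNorm_le {f : Rn n → ε} {M : ℝ≥0∞} (h : ∀ x r, 0 < r →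
    eLpNorm f p (volume.restrict (ball x r)) ≤ ENNReal.ofReal (r ^ ((n - lam) / p.toReal)) * M) :
    morreyNorm p lam f ≤ M := by
  refine iSup_le fun x => iSup_le fun r => iSup_le fun hr => ?_
  refine (mul_le_mul_right (h x r hr) _).trans (le_of_eq ?_)
  rw [← mul_assoc, ← ENNReal.ofReal_mul (by positivity), ← Real.rpow_add hr, ← add_div]
  simp

theorem morreyNorm_congr_ae {f g : Rn n → ε} (h : f =ᵐ[volume] g) :
    morreyNorm p lam f = morreyNorm p lam g := by
  unfold morreyNorm
  refine iSup_congr fun x => iSup_congr fun r => iSup_congr fun _ => ?_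
  rw [eLpNorm_congr_enorm_ae (ae_restrict_of_ae (h.mono fun _ hx => congrArg _ hx))]

end Morrey

theorem eLpNorm_lt_top_of_morreyNorm {ε : Type*} [TopologicalSpace ε]
    [ContinuousENorm ε] {p : ℝ≥0∞} {lam : ℝ} (f : Rn n → ε) (hf : morreyNorm p lam f < ∞)
    {K : Set (Rn n)} (hK : IsCompact K) : eLpNorm f p (volume.restrict K) < ∞ := by
  obtain ⟨r, hr, hKr⟩ := hK.isBounded.subset_ball_lt 0 (0 : Rn n)
  have h1 : eLpNorm f p (volume.restrict K) ≤ eLpNorm f p (volume.restrict (ball (0 : Rn n) r)) :=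
    eLpNorm_mono_measure f (Measure.restrict_mono_set volume hKr)
  have h2 := eLpNorm_ball_le (p := p) (lam := lam) f (0 : Rn n) hr
  have h3 : ENNReal.ofReal (r ^ ((n - lam) / p.toReal)) * morreyNorm p lam f < ∞ :=
    ENNReal.mul_lt_top ENNReal.ofReal_lt_top hf
  exact (h1.trans h2).trans_lt h3

theorem MemMorrey.aemeasurable {p : ℝ≥0∞} {lam : ℝ} {f : Rn n → ℝ} (hf : MemMorrey p lam f) :
    AEMeasurable f volume := by
  have hU : (⋃ k : ℕ, closedBall (0 : Rn n) k) = univ := iUnion_closedBall_nat 0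
  rw [← Measure.restrict_univ (μ := volume), ← hU]
  exact AEMeasurable.iUnion fun k =>
    (hf.1 _ (isCompact_closedBall 0 k)).aestronglyMeasurable.aemeasurable

end

/-! ### Sufficiency of `BMO`. -/

section

variable {n : ℕ}

theorem MemBMO.exists_meanOscillationLE {b : Rn n → ℝ} (hb : MemBMO b) (hbm : Measurable b) :
    ∃ A > 0, MeanOscillationLE volume (fun z : Fin n → ℝ => b (WithLp.toLp 2 z)) A := by
  have hint (c : Fin n → ℝ) (r : ℝ) :
      IntegrableOn (fun z : Fin n → ℝ => b (WithLp.toLp 2 z)) (closedBall c r) volume := by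
    have hK : IsCompact ((WithLp.toLp 2 : (Fin n → ℝ) → Rn n) '' closedBall c r) :=
      (isCompact_closedBall c r).image (PiLp.continuous_toLp 2 _)
    have h := ((PiLp.volume_preserving_toLp (Fin n)).integrableOn_comp_preimage
      measurableEmbedding_toLp).2 (hb.1.integrableOn_isCompact hK)
    rwa [preimage_image_eq _ measurableEmbedding_toLp.injective] at h
  -- Adding `1` keeps the constant positive when `b` has zero seminorm, since John–Nirenberg is
  -- applied with `A > 0`.
  refine ⟨(bmoSeminorm b).toReal + 1, by positivity, hbm.comp measurableEmbedding_toLp.measurable,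
    hint, fun c r hr => ?_⟩
  obtain ⟨a, rfl⟩ := exists_cubeCenter_eq c r
  have hr2 : 2 * r / 2 = r := by ring
  have hr0 : 0 ≤ 2 * r := by positivity
  set B := closedBall (cubeCenter a (2 * r)) r
  have hB : volume B ≠ ∞ := measure_closedBall_lt_top.ne
  have hB0 : volume B ≠ 0 := (measure_closedBall_pos _ _ hr).ne'
  set m := ballMean volume (fun z : Fin n → ℝ => b (WithLp.toLp 2 z)) (cubeCenter a (2 * r)) r
    with hm
  have hav : ⨍⁻ z in B, ‖b (WithLp.toLp 2 z) - m‖ₑ ∂volume ≤ bmoSeminorm b := by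
    have h : ⨍⁻ y in cube a (2 * r), ‖b y - ⨍ z in cube a (2 * r), b z ∂volume‖ₑ ∂volume ≤
        bmoSeminorm b :=
      le_iSup_of_le a (le_iSup_of_le (2 * r) (le_iSup_of_le (by positivity) le_rfl))
    rwa [setAverage_cube b a hr0, setLAverage_cube _ a hr0, hr2] at h
  rw [setLAverage_eq, ENNReal.div_le_iff hB0 hB] at hav
  have h1 : ENNReal.ofReal (∫ z in B, |b (WithLp.toLp 2 z) - m|) ≤ bmoSeminorm b * volume B := by
    rw [ofReal_integral_eq_lintegral_ofReal (integrableOn_abs_sub_const hB (hint _ _) m)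
      (Eventually.of_forall fun _ => abs_nonneg _)]
    refine le_trans (le_of_eq ?_) hav
    exact lintegral_congr fun z => (Real.enorm_eq_ofReal_abs _).symm
  rw [ENNReal.ofReal_le_iff_le_toReal (ENNReal.mul_ne_top hb.2.ne hB), ENNReal.toReal_mul] at h1
  refine h1.trans ?_
  rw [measureReal_def]
  gcongr
  linarith

/-- The maximal commutator with a `BMO` function is bounded on Morrey spaces with positive
parameter. -/
theorem MemBMO.maximalCommutatorBounded {b : Rn n → ℝ} (hb : MemBMO b) {p : ℝ≥0∞} (hp : 1 < p)
    (hp' : p < ∞) {lam : ℝ} (hlam : 0 < lam) : MaximalCommutatorBounded p lam b := by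
  have hbae : AEMeasurable b volume := hb.1.aestronglyMeasurable.aemeasurable
  set b' := hbae.mk b
  have hb'm : Measurable b' := hbae.measurable_mk
  have hbb' : b =ᵐ[volume] b' := hbae.ae_eq_mk
  obtain ⟨A, hA, hosc⟩ := (hb.congr_ae hbb').exists_meanOscillationLE hb'm
  set P := p.toReal
  have hP : 1 < P := by
    have := (ENNReal.toReal_lt_toReal ENNReal.one_ne_top hp'.ne).2 hp
    simpa using this
  have hP0 : 0 < P := by linarith
  have hp0 : p ≠ 0 := (zero_lt_one.trans hp).ne'
  obtain ⟨C, hC, hCg⟩ := hosc.exists_setLIntegral_ratCommutator_le hA hP hlam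
  set K : ℝ≥0∞ := (C * ENNReal.ofReal ((n + 1) ^ (n - lam))) ^ (1 / P)
  have hK : K ≠ ∞ := ENNReal.rpow_ne_top_of_nonneg (by positivity) (by finiteness)
  have hrpow (s r : ℝ) (hr : 0 < r) :
      ENNReal.ofReal (r ^ (s / P)) ^ P = ENNReal.ofReal (r ^ s) := by
    rw [ENNReal.ofReal_rpow_of_pos (by positivity), ← Real.rpow_mul hr.le,
      div_mul_cancel₀ _ hP0.ne']
  refine ⟨K.toNNReal, fun f hf => ?_⟩
  rw [ENNReal.coe_toNNReal hK]
  have hfae := hf.aemeasurable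
  set f' := hfae.mk f
  have hf'm : Measurable f' := hfae.measurable_mk
  have hff' : f =ᵐ[volume] f' := hfae.ae_eq_mk
  have hcomm := maximalCommutator_congr_ae hbb' hff'
  have hcm := measurable_maximalCommutator hb'm hf'm
  set g : (Fin n → ℝ) → ℝ≥0∞ := fun z => ‖f' (WithLp.toLp 2 z)‖ₑ with hg
  have hgm : Measurable g := (hf'm.comp measurableEmbedding_toLp.measurable).enorm
  set N₀ := morreyNorm p lam f with hN₀
  have hN₀' : morreyNorm p lam f' = N₀ := (morreyNorm_congr_ae hff').symm
  -- A cube of half-side `r` sits in a Euclidean ball of radius `(n + 1) * r`, which explains the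
  -- factor `(n + 1) ^ (n - lam)`.
  have hgN (c : Fin n → ℝ) (r : ℝ) (hr : 0 < r) : ∫⁻ y in closedBall c r, g y ^ P ≤
      ENNReal.ofReal (r ^ (n - lam)) * (ENNReal.ofReal ((n + 1) ^ (n - lam)) * N₀ ^ P) := by
    have hR : 0 < (n + 1) * r := by positivity
    have h1 : ∫⁻ y in closedBall c r, g y ^ P ≤
        ∫⁻ y in ball (WithLp.toLp 2 c : Rn n) ((n + 1) * r), ‖f' y‖ₑ ^ P := by
      rw [← (PiLp.volume_preserving_toLp _).setLIntegral_comp_preimage_emb measurableEmbedding_toLp]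
      exact lintegral_mono_set (closedBall_subset_toLp_preimage_ball c hr)
    have h2 := ENNReal.rpow_le_rpow
      (eLpNorm_ball_le (p := p) (lam := lam) f' (WithLp.toLp 2 c) hR) hP0.le
    rw [eLpNorm_eq_lintegral_rpow_enorm_toReal hp0 hp'.ne, ← ENNReal.rpow_mul,
      one_div_mul_cancel hP0.ne', ENNReal.rpow_one, ENNReal.mul_rpow_of_nonneg _ _ hP0.le,
      hrpow _ _ hR, hN₀', Real.mul_rpow (by positivity) hr.le,
      ENNReal.ofReal_mul (by positivity)] at h2
    refine h1.trans (h2.trans (le_of_eq ?_))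
    ring
  have hnorm : morreyNorm p lam (maximalCommutator b f) ≤ K * N₀ := by
    rw [morreyNorm_congr_ae hcomm]
    refine morreyNorm_le fun x r hr => ?_
    rw [eLpNorm_eq_lintegral_rpow_enorm_toReal hp0 hp'.ne,
      ← (PiLp.volume_preserving_toLp _).setLIntegral_comp_preimage_emb measurableEmbedding_toLp]
    calc (∫⁻ z in WithLp.toLp 2 ⁻¹' ball x r,
          ‖maximalCommutator b' f' (WithLp.toLp 2 z)‖ₑ ^ P) ^ (1 / P)
        ≤ (∫⁻ z in closedBall (WithLp.ofLp x) r,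
            ratCommutator (fun z => b' (WithLp.toLp 2 z)) g z ^ P) ^ (1 / P) := by
          refine ENNReal.rpow_le_rpow ?_ (by positivity)
          refine (lintegral_mono_set (toLp_preimage_ball_subset x hr)).trans (le_of_eq ?_)
          refine lintegral_congr fun z => ?_
          rw [maximalCommutator_eq_ratCommutator, enorm_eq_self]
      _ ≤ (C * (ENNReal.ofReal (r ^ (n - lam)) *
            (ENNReal.ofReal ((n + 1) ^ (n - lam)) * N₀ ^ P))) ^ (1 / P) := by
          gcongr
          exact hCg g hgm _ hgN _ r hr
      _ = ((C * ENNReal.ofReal ((n + 1) ^ (n - lam))) *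
            (ENNReal.ofReal (r ^ ((n - lam) / P)) * N₀) ^ P) ^ (1 / P) := by
          rw [ENNReal.mul_rpow_of_nonneg _ N₀ hP0.le, hrpow _ _ hr]
          congr 1
          ring
      _ = _ := by
          rw [ENNReal.mul_rpow_of_nonneg _ _ (by positivity), ← ENNReal.rpow_mul,
            mul_one_div_cancel hP0.ne', ENNReal.rpow_one]
          ring
  have hfin : morreyNorm p lam (maximalCommutator b f) < ∞ :=
    hnorm.trans_lt (ENNReal.mul_lt_top hK.lt_top hf.2)
  refine ⟨⟨fun S hS => ⟨?_, eLpNorm_lt_top_of_morreyNorm _ hfin hS⟩, hfin⟩, hnorm⟩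
  exact (hcm.aemeasurable.congr hcomm.symm).aestronglyMeasurable.restrict

end

/-! ### Necessity of `BMO`, by testing on indicators of cubes. -/

section

variable {n : ℕ}

theorem volume_ball_le (x : Rn n) {r : ℝ} (hr : 0 < r) :
    volume (ball x r) ≤ ENNReal.ofReal ((2 * r) ^ n) := by
  rw [← (PiLp.volume_preserving_toLp _).measure_preimage_emb measurableEmbedding_toLp,
    ← volume_closedBall_pi (WithLp.ofLp x) hr.le]
  exact measure_mono (toLp_preimage_ball_subset x hr)

/-- The Morrey norm of the indicator function of a cube. -/
theorem morreyNorm_indicator_cube_le {p : ℝ≥0∞} (hp : 1 < p) (hp' : p < ∞) {lam : ℝ}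
    (hlam : 0 ≤ lam) (hlam' : lam ≤ n) (a : Rn n) {l : ℝ} (hl : 0 < l) :
    morreyNorm p lam ((cube a l).indicator fun _ => (1 : ℝ)) ≤
      ENNReal.ofReal ((2 ^ n * l ^ lam) ^ (1 / p.toReal)) := by
  have hP : 0 < p.toReal := ENNReal.toReal_pos (zero_lt_one.trans hp).ne' hp'.ne
  refine morreyNorm_le fun x r hr => ?_
  rw [eLpNorm_indicator_const (measurableSet_cube a l) (zero_lt_one.trans hp).ne' hp'.ne,
    Measure.restrict_apply (measurableSet_cube a l), enorm_one, one_mul]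
  -- For `r ≤ l` the volume of the ball is used and `r ^ lam ≤ l ^ lam`; for `l ≤ r` the volume of
  -- the cube is used and `l ^ (n - lam) ≤ r ^ (n - lam)`. These need `0 ≤ lam` and `lam ≤ n`
  -- respectively.
  have key : volume (cube a l ∩ ball x r) ≤ ENNReal.ofReal (r ^ (n - lam) * (2 ^ n * l ^ lam)) := by
    rcases le_total r l with hrl | hrl
    · refine (measure_mono inter_subset_right).trans ((volume_ball_le x hr).trans ?_)
      refine ENNReal.ofReal_le_ofReal ?_
      rw [mul_pow]
      have h1 : r ^ n = r ^ (n - lam) * r ^ lam := by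
        rw [← Real.rpow_add hr, sub_add_cancel, Real.rpow_natCast]
      rw [h1, mul_left_comm]
      gcongr
    · refine (measure_mono inter_subset_left).trans (le_of_eq_of_le (volume_cube a hl.le) ?_)
      refine ENNReal.ofReal_le_ofReal ?_
      have h1 : l ^ n = l ^ (n - lam) * l ^ lam := by
        rw [← Real.rpow_add hl, sub_add_cancel, Real.rpow_natCast]
      have h2 : (1 : ℝ) ≤ 2 ^ n := one_le_pow₀ (by norm_num)
      have h3 : l ^ (n - lam) ≤ r ^ (n - lam) := by
        gcongr
      calc l ^ n = l ^ (n - lam) * (1 * l ^ lam) := by rw [h1, one_mul]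
        _ ≤ _ := by gcongr
  refine (ENNReal.rpow_le_rpow key (by positivity)).trans (le_of_eq ?_)
  rw [ENNReal.ofReal_rpow_of_pos (by positivity), Real.mul_rpow (by positivity) (by positivity),
    ENNReal.ofReal_mul (by positivity), ← Real.rpow_mul hr.le, mul_one_div]

theorem memMorrey_indicator_cube {p : ℝ≥0∞} (hp : 1 < p) (hp' : p < ∞) {lam : ℝ}
    (hlam : 0 ≤ lam) (hlam' : lam ≤ n) (a : Rn n) {l : ℝ} (hl : 0 < l) :
    MemMorrey p lam ((cube a l).indicator fun _ => (1 : ℝ)) := by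
  have hfin := (morreyNorm_indicator_cube_le hp hp' hlam hlam' a hl).trans_lt ENNReal.ofReal_lt_top
  refine ⟨fun K hK => ⟨?_, eLpNorm_lt_top_of_morreyNorm _ hfin hK⟩, hfin⟩
  exact (measurable_const.indicator (measurableSet_cube a l)).aestronglyMeasurable

theorem enorm_sub_average_le {X : Type*} [MeasurableSpace X] {μ : Measure X} {s : Set X}
    (hs0 : μ s ≠ 0) (hs : μ s ≠ ∞) {b : X → ℝ} (hb : IntegrableOn b s μ) (x : ℝ) :
    ‖x - ⨍ y in s, b y ∂μ‖ₑ ≤ ⨍⁻ y in s, ‖x - b y‖ₑ ∂μ := by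
  have hpos : 0 < μ.real s := ENNReal.toReal_pos hs0 hs
  have hc : IntegrableOn (fun _ : X => x) s μ := integrableOn_const hs
  have h : x - ⨍ y in s, b y ∂μ = (μ.real s)⁻¹ * ∫ y in s, (x - b y) ∂μ := by
    rw [setAverage_eq, integral_sub hc hb, setIntegral_const, smul_eq_mul,
      smul_eq_mul, mul_sub, inv_mul_cancel_left₀ hpos.ne']
  rw [h, enorm_mul, setLAverage_eq, div_eq_mul_inv, mul_comm, enorm_inv hpos.ne',
    Real.enorm_eq_ofReal hpos.le, ofReal_measureReal hs]
  gcongr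
  exact enorm_integral_le_lintegral_enorm _

/-- A function whose double mean oscillations over cubes are uniformly bounded belongs to `BMO`. -/
theorem memBMO_of_setLIntegral_setLAverage_le {b : Rn n → ℝ} (hb : AEMeasurable b volume)
    {K : ℝ≥0∞} (hK : K ≠ ∞) (h : ∀ (a : Rn n) (l : ℝ), 0 < l →
      ∫⁻ x in cube a l, ⨍⁻ y in cube a l, ‖b x - b y‖ₑ ∂volume ≤ K * volume (cube a l)) :
    MemBMO b := by
  have hint (a : Rn n) {l : ℝ} (hl : 0 < l) : IntegrableOn b (cube a l) volume := by
    have hQ0 := volume_cube_pos a hl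
    have hQ := volume_cube_ne_top a hl.le
    -- Local integrability is not assumed: a finite double integral has a finite inner mean at some
    -- `x`, and then `b` differs from the constant `b x` by an integrable function on the cube.
    obtain ⟨x, hx⟩ : ∃ x, ⨍⁻ y in cube a l, ‖b x - b y‖ₑ ∂volume < ∞ := by
      by_contra! hcon
      have h1 := h a l hl
      simp only [fun x => top_le_iff.1 (hcon x), lintegral_const, Measure.restrict_apply_univ,
        ENNReal.top_mul hQ0, top_le_iff] at h1
      exact ENNReal.mul_ne_top hK hQ h1
    rw [setLAverage_eq] at hx
    have hx' : ∫⁻ y in cube a l, ‖b x - b y‖ₑ < ∞ := by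
      by_contra hcon
      rw [not_lt, top_le_iff] at hcon
      rw [hcon, ENNReal.top_div_of_ne_top hQ] at hx
      exact lt_irrefl _ hx
    have hd : IntegrableOn (fun y => b x - b y) (cube a l) volume :=
      ⟨(aemeasurable_const.sub hb.restrict).aestronglyMeasurable, hx'⟩
    have hc : IntegrableOn (fun _ : Rn n => b x) (cube a l) volume := integrableOn_const hQ
    refine (hc.sub hd).congr (Eventually.of_forall fun y => ?_)
    simp
  refine ⟨fun x => ?_, lt_of_le_of_lt ?_ hK.lt_top⟩
  · refine ⟨cube (WithLp.toLp 2 fun i => x i - 1) 2, ?_, hint _ (by norm_num)⟩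
    filter_upwards [ball_mem_nhds x one_pos] with y hy i
    have h1 := PiLp.norm_apply_le (y - x) i
    rw [mem_ball, dist_eq_norm] at hy
    have h2 : |y i - x i| ≤ 1 := h1.trans hy.le
    rw [abs_le] at h2
    simp only [mem_Icc]
    constructor <;> linarith [h2.1, h2.2]
  · refine iSup_le fun a => iSup_le fun l => iSup_le fun hl => ?_
    have hQ0 := volume_cube_pos a hl
    have hQ := volume_cube_ne_top a hl.le
    rw [setLAverage_eq, ENNReal.div_le_iff hQ0 hQ]
    refine (lintegral_mono fun x => ?_).trans (h a l hl)
    exact enorm_sub_average_le hQ0 hQ (hint a hl) _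

/-- If the maximal commutator of `b` is bounded on a Morrey space, then `b` belongs to `BMO`. -/
theorem MaximalCommutatorBounded.memBMO {b : Rn n → ℝ} (hb : AEMeasurable b volume) {p : ℝ≥0∞}
    (hp : 1 < p) (hp' : p < ∞) {lam : ℝ} (hlam : 0 ≤ lam) (hlam' : lam ≤ n)
    (h : MaximalCommutatorBounded p lam b) : MemBMO b := by
  obtain ⟨c, hc⟩ := h
  set P := p.toReal with hPdef
  have hP : 0 < P := ENNReal.toReal_pos (zero_lt_one.trans hp).ne' hp'.ne
  set K : ℝ := ((n + 1) ^ (n - lam) * 2 ^ n) ^ (1 / P) with hK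
  refine memBMO_of_setLIntegral_setLAverage_le hb (K := c * ENNReal.ofReal K) (by finiteness)
    fun a l hl => ?_
  set Q := cube a l with hQdef
  set f : Rn n → ℝ := Q.indicator fun _ => (1 : ℝ) with hf
  obtain ⟨hmem, hle⟩ := hc f (memMorrey_indicator_cube hp hp' hlam hlam' a hl)
  have hlow (x : Rn n) (hx : x ∈ Q) : ⨍⁻ y in Q, ‖b x - b y‖ₑ ∂volume ≤ maximalCommutator b f x := by
    refine le_trans (le_of_eq ?_) (le_iSup_of_le a (le_iSup_of_le l (le_iSup_of_le hl
      (le_iSup_of_le hx le_rfl))))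
    refine setLAverage_congr_fun (measurableSet_cube a l) fun y hy => ?_
    simp only [hf]
    rw [indicator_of_mem hy, enorm_one, mul_one]
  have hR : 0 < (n + 1) * l := by positivity
  have hsub : Q ⊆ ball a ((n + 1) * l) := cube_subset_ball a hl
  have hmeas : AEStronglyMeasurable (maximalCommutator b f) (volume.restrict Q) :=
    ((hmem.1 _ (isCompact_closedBall a ((n + 1) * l))).aestronglyMeasurable).mono_measure
      (Measure.restrict_mono_set _ (hsub.trans ball_subset_closedBall))
  calc ∫⁻ x in Q, ⨍⁻ y in Q, ‖b x - b y‖ₑ ∂volume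
      ≤ ∫⁻ x in Q, ‖maximalCommutator b f x‖ₑ :=
        setLIntegral_mono' (measurableSet_cube a l) fun x hx => by
          rw [enorm_eq_self]; exact hlow x hx
    _ = eLpNorm (maximalCommutator b f) 1 (volume.restrict Q) :=
        eLpNorm_one_eq_lintegral_enorm.symm
    _ ≤ eLpNorm (maximalCommutator b f) p (volume.restrict Q) *
          volume Q ^ (1 / (1 : ℝ≥0∞).toReal - 1 / P) := by
        have := eLpNorm_le_eLpNorm_mul_rpow_measure_univ hp.le hmeas
        rwa [Measure.restrict_apply_univ] at this
    _ ≤ (ENNReal.ofReal (((n + 1) * l) ^ ((n - lam) / P)) *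
          (c * ENNReal.ofReal ((2 ^ n * l ^ lam) ^ (1 / P)))) *
            volume Q ^ (1 / (1 : ℝ≥0∞).toReal - 1 / P) := by
        gcongr
        refine (eLpNorm_mono_measure _ (Measure.restrict_mono_set _ hsub)).trans ?_
        refine (eLpNorm_ball_le (lam := lam) _ a hR).trans ?_
        gcongr
        refine hle.trans ?_
        gcongr
        exact morreyNorm_indicator_cube_le hp hp' hlam hlam' a hl
    _ = c * ENNReal.ofReal K * volume Q := by
        rw [volume_cube a hl.le, ENNReal.toReal_one, div_one,
          ENNReal.ofReal_rpow_of_pos (by positivity), mul_left_comm (ENNReal.ofReal _),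
          ← ENNReal.ofReal_mul (by positivity), mul_assoc, ← ENNReal.ofReal_mul (by positivity),
          mul_assoc (c : ℝ≥0∞) (ENNReal.ofReal K), ← ENNReal.ofReal_mul (by positivity)]
        -- The powers of `l` are `(n - lam) / P` from the enclosing ball, `lam / P` from the test
        -- function and `n * (1 - 1 / P)` from Hölder. They add up to `n`, so the constant is
        -- independent of the cube.
        congr 2
        rw [hK, ← Real.rpow_natCast l n, ← Real.rpow_mul hl.le, ← mul_one_div (n - lam) P,
          Real.rpow_mul (by positivity), Real.mul_rpow (by positivity) hl.le,
          ← Real.mul_rpow (by positivity) (by positivity)]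
        have e1 : (n + 1 : ℝ) ^ (n - lam) * l ^ (n - lam) * (2 ^ n * l ^ lam) =
            ((n + 1) ^ (n - lam) * 2 ^ n) * l ^ (n : ℝ) := by
          have : l ^ (n : ℝ) = l ^ (n - lam) * l ^ lam := by
            rw [← Real.rpow_add hl, sub_add_cancel]
          rw [this]
          ring
        rw [e1, Real.mul_rpow (by positivity) (by positivity), mul_assoc, ← Real.rpow_mul hl.le,
          ← Real.rpow_add hl]
        congr 2
        ring

end

end MorreyCommutator

end

theorem mainTheorem8 (n : ℕ) (hn : 1 ≤ n) (p : ℝ≥0∞) (hp_one : 1 < p) (hp_top : p < ∞)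
    (lam : ℝ) (hlam_nonneg : 0 ≤ lam) (hlam_le : lam ≤ n)
    (b : MorreyCommutator.Rn n → ℝ) (hb : AEMeasurable b volume) :
    (0 < lam →
      (MorreyCommutator.MemBMO b ↔ MorreyCommutator.MaximalCommutatorBounded p lam b)) ∧
    (MorreyCommutator.MaximalCommutatorBounded p lam b → MorreyCommutator.MemBMO b) := by
  refine ⟨fun hlam => ⟨fun h => h.maximalCommutatorBounded hp_one hp_top hlam, fun h => ?_⟩,
    fun h => ?_⟩ <;>
  exact h.memBMO hb hp_one hp_top hlam_nonneg hlam_le
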